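/- Let $L$ be a bilateral classic tempered stable (BCTS) process of finite variation, that is, a real Lévy process (with càdlàg paths) without Gaussian part and without drift, with $$\mathbb E\,e^{iuL(t)}=\exp\Big(t\int_{\mathbb R}(e^{iux}-1)\,\nu(x)\,dx\Big),\qquad \nu(x)=c_p\frac{e^{-\beta_p x}}{x^{1+\alpha_p}}\mathbf 1_{x>0}+c_n\frac{e^{\beta_n x}}{|x|^{1+\alpha_n}}\mathbf 1_{x<0},$$ where $c_p,c_n,\beta_p,\beta_n>0$ and $\alpha_p,\alpha_n\in(-\infty,1)\setminus\{0\}$. Let $b>0$ and let $X$ be the Ornstein–Uhlenbeck (OU-BCTS) process $X(t)=X(0)e^{-bt}+Z(t)$ with $Z(t)=\int_0^t e^{-b(t-s)}\,dL(s)$ (a pathwise integral, which exists almost surely). Then for every $t\ge 0$, with $a=e^{-bt}$, the log-characteristic function of $Z(t)$, i.e. the continuous function $u\mapsto\psi_Z(u,t)$ on $\mathbb R$ with $\psi_Z(0,t)=0$ and $e^{\psi_Z(u,t)}=\mathbb E\,e^{iuZ(t)}$, is $$\psi_Z(u,t)=-\frac{c_p\beta_p^{\alpha_p}\Gamma(1-\alpha_p)}{\alpha_p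 b}\Big[I\big(u,\alpha_p,\beta_p,\tfrac{\beta_p}{a}\big)+\log a\Big]-\frac{c_n\beta_n^{\alpha_n}\Gamma(1-\alpha_n)}{\alpha_n b}\Big[I\big(-u,\alpha_n,\beta_n,\tfrac{\beta_n}{a}\big)+\log a\Big],\qquad u\in\mathbb R,$$ where $I(u,\alpha,\beta_1,\beta_2)=\int_{\beta_1}^{\beta_2}z^{-1-\alpha}(z-iu)^{\alpha}\,dz$. Moreover, for $u\neq0$ both integrals $I(v,\alpha,\beta_1,\beta_2)$ occurring here, that is, for $(v,\alpha,\beta_1,\beta_2)=(u,\alpha_p,\beta_p,\beta_p/a)$ and $(-u,\alpha_n,\beta_n,\beta_n/a)$, have the form $$I(v,\alpha,\beta_1,\beta_2)=-\frac1\alpha\Big[\Big(\frac{v}{i\beta_2}\Big)^{\alpha}{}_2F_1\Big(-\alpha,-\alpha;1-\alpha;-\frac{i\beta_2}{v}\Big)-\Big(\frac{v}{i\beta_1}\Big)^{\alpha}{}_2F_1\Big(-\alpha,-\alpha;1-\alpha;-\frac{i\beta_1}{v}\Big)\Big],$$ with principal powers and with ${}_2F_1$ the principal branch of the Gauss hypergeometric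 function, i.e. the analytic continuation of the hypergeometric series to $\mathbb C\setminus[1,\infty)$ (which exists for these parameters). In particular this holds for OU-CGMY processes ($c_p=c_n$, $\alpha_p=\alpha_n$). -/

import Mathlib

open MeasureTheory ProbabilityTheory Filter Topology
open scoped NNReal

noncomputable section

/-- `f` is càdlàg: right-continuous with left limits at every point of `[0, ∞)`. -/
def IsCadlagPath (f : ℝ≥0 → ℝ) : Prop :=
  ∀ t, ContinuousWithinAt f (Set.Ici t) t ∧ ∃ l, Tendsto f (𝓝[<] t) (𝓝 l)

/-- `L` is a real Lévy process under `P`: it starts at `0` almost surely, has independent and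
stationary increments, and almost all of its paths are càdlàg. -/
structure IsLevyProcess {Ω : Type*} [MeasurableSpace Ω] (L : ℝ≥0 → Ω → ℝ) (P : Measure Ω) :
    Prop where
  measurable : ∀ t, Measurable (L t)
  zero : ∀ᵐ ω ∂P, L 0 ω = 0
  indep : HasIndepIncrements L P
  stationary : ∀ s h : ℝ≥0, IdentDistrib (fun ω => L (s + h) ω - L s ω) (L h) P P
  cadlag : ∀ᵐ ω ∂P, IsCadlagPath (fun t => L t ω)

/-- The density of the (bilateral) classic tempered stable Lévy measure:
`cp e^{-βp x} / x^{1+αp}` for `x > 0` and `cn e^{βn x} / |x|^{1+αn}` for `x < 0`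
(the value at the single point `0` is irrelevant). -/
def bctsDensity (αp αn βp βn cp cn : ℝ) (x : ℝ) : ℝ :=
  if 0 < x then cp * Real.exp (-βp * x) / x ^ (1 + αp)
  else if x < 0 then cn * Real.exp (βn * x) / |x| ^ (1 + αn)
  else 0

/-- The bilateral classic tempered stable Lévy measure. -/
def bctsLevyMeasure (αp αn βp βn cp cn : ℝ) : Measure ℝ :=
  volume.withDensity fun x => ENNReal.ofReal (bctsDensity αp αn βp βn cp cn x)

/-- `L` is a bilateral classic tempered stable (BCTS) process of finite variation: a driftless,
purely discontinuous Lévy process with Lévy measure `bctsLevyMeasure`, that is, with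
Lévy-Khintchine representation `E[e^{iuL(t)}] = exp (t ∫ (e^{iux} - 1) ν(dx))`. -/
structure IsBCTSProcess {Ω : Type*} [MeasurableSpace Ω] (αp αn βp βn cp cn : ℝ)
    (L : ℝ≥0 → Ω → ℝ) (P : Measure Ω) : Prop where
  levy : IsLevyProcess L P
  levyKhintchine : ∀ (t : ℝ≥0) (u : ℝ), charFun (P.map (L t)) u =
    Complex.exp ((t : ℝ) *
      ∫ x : ℝ, (Complex.exp (Complex.I * u * x) - 1) ∂(bctsLevyMeasure αp αn βp βn cp cn))

/-- `J` is the Riemann-Stieltjes integral `∫_0^t f dg`: the sums `∑ f(ξ i) (g(x (i+1)) - g(x i))`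
over tagged partitions `0 = x 0 ≤ ξ 0 ≤ x 1 ≤ ξ 1 ≤ ⋯ ≤ x n = t` tend to `J` as the mesh tends
to `0`. For `f` continuous and `g` càdlàg of finite variation this is the
Lebesgue-Stieltjes integral over `(0, t]`. -/
def HasRSIntegral (f g : ℝ≥0 → ℝ) (t : ℝ≥0) (J : ℝ) : Prop :=
  ∀ ε : ℝ, 0 < ε → ∃ δ : ℝ, 0 < δ ∧
    ∀ (n : ℕ) (x ξ : ℕ → ℝ≥0), x 0 = 0 → x n = t →
      (∀ i < n, x i ≤ ξ i ∧ ξ i ≤ x (i + 1) ∧ (x (i + 1) : ℝ) - x i < δ) →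
      |(∑ i ∈ Finset.range n, f (ξ i) * (g (x (i + 1)) - g (x i))) - J| < ε

open Classical in
/-- The Riemann-Stieltjes integral `∫_0^t f dg` (`0` if it does not exist). -/
def rsIntegral (f g : ℝ≥0 → ℝ) (t : ℝ≥0) : ℝ :=
  if h : ∃ J, HasRSIntegral f g t J then h.choose else 0

/-- The kernel `s ↦ e^{-b (t - s)}`. -/
def ouKernel (b : ℝ) (t s : ℝ≥0) : ℝ := Real.exp (-b * ((t : ℝ) - s))

/-- The process `Z(t) = ∫_0^t e^{-b (t - s)} dL(s)`, integrated path by path. -/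
def ouZ {Ω : Type*} (b : ℝ) (L : ℝ≥0 → Ω → ℝ) (t : ℝ≥0) (ω : Ω) : ℝ :=
  rsIntegral (ouKernel b t) (fun s => L s ω) t

/-- `X` is an OU-BCTS process with mean-reversion rate `b` and background driving process `L`:
`X(t) = X(0) e^{-bt} + ∫_0^t e^{-b (t - s)} dL(s)` where `L` is a BCTS process. -/
structure IsOUBCTSProcess {Ω : Type*} [MeasurableSpace Ω] (b αp αn βp βn cp cn : ℝ)
    (L X : ℝ≥0 → Ω → ℝ) (P : Measure Ω) : Prop where
  driver : IsBCTSProcess αp αn βp βn cp cn L P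
  solution : ∀ᵐ ω ∂P, ∀ t : ℝ≥0, X t ω = X 0 ω * Real.exp (-b * t) + ouZ b L t ω

/-- `ψ` is the log-characteristic function of the law `μ`: the (unique) continuous function
with `ψ(0) = 0` and `e^ψ` equal to the characteristic function of `μ`. -/
structure IsLogCharFun (μ : Measure ℝ) (ψ : ℝ → ℂ) : Prop where
  continuous : Continuous ψ
  zero : ψ 0 = 0
  exp_eq : ∀ u, charFun μ u = Complex.exp (ψ u)

/-- `F` is the principal branch of the Gauss hypergeometric function `₂F₁(a, b; c; ·)`: it is
holomorphic on `ℂ \ [1, ∞)` and equal to the hypergeometric series on the unit disc. By the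
identity theorem there is at most one such function on `ℂ \ [1, ∞)`. -/
def IsPrincipalHypergeometric (a b c : ℂ) (F : ℂ → ℂ) : Prop :=
  DifferentiableOn ℂ F {z | 1 - z ∈ Complex.slitPlane} ∧
    ∀ z : ℂ, ‖z‖ < 1 → F z = ordinaryHypergeometric a b c z

open Classical in
/-- The principal branch of the Gauss hypergeometric function on `ℂ \ [1, ∞)`. -/
def gaussHypergeometric (a b c : ℂ) : ℂ → ℂ :=
  if h : ∃ F, IsPrincipalHypergeometric a b c F then h.choose else 0

/-- `I(u, α, β₁, β₂) = ∫_{β₁}^{β₂} z^{-1-α} (z - iu)^α dz` (principal power). -/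
def ctsI (u α β₁ β₂ : ℝ) : ℂ :=
  ∫ z in β₁..β₂, ((z ^ (-1 - α) : ℝ) : ℂ) * ((z : ℂ) - Complex.I * u) ^ (α : ℂ)

/-- `(u / (iβ))^α ₂F₁(-α, -α; 1 - α; -iβ/u)` (principal power). -/
def ctsHypTerm (u α β : ℝ) : ℂ :=
  ((u : ℂ) / (Complex.I * β)) ^ (α : ℂ) *
    gaussHypergeometric (-α) (-α) (1 - α) (-(Complex.I * β) / u)

/-- The CTS-type term
`-(c β^α Γ(1-α) / (α b)) [I(u, α, β, β/a) + log a]`, where `a = e^{-bt}`. -/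
def ouCTSLogChar (b α β c : ℝ) (t : ℝ≥0) (u : ℝ) : ℂ :=
  -((c * β ^ α * Real.Gamma (1 - α) / (α * b) : ℝ) : ℂ) *
    (ctsI u α β (β / Real.exp (-b * t)) + (Real.log (Real.exp (-b * t)) : ℂ))

end

/-! A càdlàg path is bounded on compacts and has countably many discontinuities, so integration by
parts against the smooth kernel gives the pathwise integral as a genuine Riemann-Stieltjes limit
(`hasRSIntegral_of_isCadlagPath`). Hence `Z(t)` is an almost sure limit of weighted sums of
independent stationary increments. Their characteristic functions are exponentials of Riemann sums,
so the exponent of `Z(t)` is `∫_0^t ψ(e^{-b(t-s)} u) ds`, with `ψ` the exponent of `L`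
(`IsLevyProcess.charFun_map_rsIntegral`). This form is visibly continuous in `u` and zero at `0`,
which settles the branch of the logarithm.

The Lévy-Khintchine integral splits into two half-lines, each giving `-Γ(1-α)/α ((β - iu)^α - β^α)`
(`integral_cexp_sub_one_mul_cts`). The substitution `z = β e^{b(t-s)}` turns the time integral of
each piece into `I + log a` (`integral_ctsExponent_exp`).

For the hypergeometric form, `F = ₂F₁(-α, -α; 1-α; ·)` satisfies the first-order equation `z F' - α
F = -α (1 - z)^α`. It makes `ctsHypTerm` an antiderivative of `-α` times the integrand of `I`. Both
the analytic continuation and the equation come from one integral representation, an average along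
rays from `0`, which makes sense on the whole cut plane because that set is star-shaped about `0`
(`hasDerivAt_ctsHypergeometric`). -/

/-! ### Pathwise Riemann-Stieltjes integration against càdlàg functions. -/

/-- A function with one-sided limits everywhere has at most countably many discontinuities. -/
theorem countable_not_continuousAt_of_tendsto_nhdsLT_nhdsGT {α E : Type*} [TopologicalSpace α]
    [LinearOrder α] [OrderTopology α] [SecondCountableTopology α] [PseudoMetricSpace E]
    {g : α → E} (hl : ∀ x, ∃ l, Tendsto g (𝓝[<] x) (𝓝 l))
    (hr : ∀ x, ∃ l, Tendsto g (𝓝[>] x) (𝓝 l)) : {x | ¬ ContinuousAt g x}.Countable := by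
  let S : ℕ → Set α := fun n => {x | ¬ ∀ᶠ p in 𝓝 x, dist (g p) (g x) < 1 / ((n : ℝ) + 1)}
  have hsub : {x | ¬ ContinuousAt g x} ⊆ ⋃ n, S n := by
    intro x hx
    simp only [Set.mem_ofPred_eq, Metric.continuousAt_iff', not_forall] at hx
    obtain ⟨ε, hε, h⟩ := hx
    obtain ⟨n, hn⟩ := exists_nat_one_div_lt hε
    exact Set.mem_iUnion.2 ⟨n, fun h' => h (h'.mono fun p hp => hp.trans hn)⟩
  refine (Set.countable_iUnion fun n => ?_).mono hsub
  -- Near `x` on one side, all values lie within half the threshold of the one-sided limit, hence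
  -- within the threshold of each other. So no nearby point on that side is in `S n`, and `S n` is
  -- discrete.
  have key : ∀ (x : α) (I : Set α), IsOpen I → (∃ l, Tendsto g (𝓝[I] x) (𝓝 l)) →
      ∀ᶠ y in 𝓝[I] x, y ∉ S n := by
    rintro x I hI ⟨l, hl⟩
    have hε : (0 : ℝ) < 1 / ((n : ℝ) + 1) / 2 := by positivity
    have h1 := (Metric.tendsto_nhds.1 hl) _ hε
    filter_upwards [h1, eventually_eventually_nhdsWithin.2 h1, self_mem_nhdsWithin]
      with y hy hy' hyI
    rw [hI.nhdsWithin_eq hyI] at hy'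
    simp only [S, Set.mem_ofPred_eq, not_not]
    filter_upwards [hy'] with z hz
    have := dist_triangle_right (g z) (g y) l
    linarith
  have hd : IsDiscrete (S n) := by
    rw [isDiscrete_iff_nhdsNE]
    intro x _
    rw [← disjoint_iff, disjoint_principal_right, ← nhdsLT_sup_nhdsGT]
    exact ⟨key x _ isOpen_Iio (hl x), key x _ isOpen_Ioi (hr x)⟩
  exact (HereditarilyLindelofSpace.isLindelof (S n)).countable_of_isDiscrete hd

namespace IsCadlagPath

variable {g : ℝ≥0 → ℝ}

theorem countable_not_continuousAt (hg : IsCadlagPath g) : {x | ¬ ContinuousAt g x}.Countable :=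
  countable_not_continuousAt_of_tendsto_nhdsLT_nhdsGT (fun x => (hg x).2)
    fun x => ⟨g x, (hg x).1.mono_left (nhdsWithin_mono _ Set.Ioi_subset_Ici_self)⟩

/-- Compactness: the left limit and right continuity bound `g` on a neighbourhood of each point. -/
theorem exists_abs_le (hg : IsCadlagPath g) (t : ℝ≥0) : ∃ C, ∀ s ≤ t, |g s| ≤ C := by
  have h : Bornology.IsBounded (g '' Set.Icc 0 t) := by
    refine (isCompact_Icc (a := (0 : ℝ≥0)) (b := t)).induction_on
      (p := fun s => Bornology.IsBounded (g '' s)) (by simp)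
      (fun s u hsu hu => hu.subset (Set.image_mono hsu))
      (fun s u hs hu => by rw [Set.image_union]; exact hs.union hu) fun x _ => ?_
    obtain ⟨hr, l, hl⟩ := hg x
    have h : g ⁻¹' (Metric.ball l 1 ∪ Metric.ball (g x) 1) ∈ 𝓝 x := by
      rw [← nhdsLT_sup_nhdsGE]
      exact ⟨hl (mem_of_superset (Metric.ball_mem_nhds l one_pos) Set.subset_union_left),
        hr (mem_of_superset (Metric.ball_mem_nhds _ one_pos) Set.subset_union_right)⟩
    exact ⟨_, mem_nhdsWithin_of_mem_nhds h,
      (Metric.isBounded_ball.union Metric.isBounded_ball).subset (Set.image_preimage_subset _ _)⟩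
  obtain ⟨C, hC⟩ := h.exists_norm_le
  exact ⟨C, fun s hs => hC _ ⟨s, ⟨zero_le, hs⟩, rfl⟩⟩

end IsCadlagPath

/-- A bounded, almost everywhere continuous function on `[0, t]` has local oscillations that are
dominated by functions of arbitrarily small integral. -/
theorem exists_oscillation_bound {G : ℝ → ℝ} {C : ℝ} (hC : ∀ s, |G s| ≤ C) {t : ℝ}
    (hG : ∀ᵐ s : ℝ, s ∈ Set.uIoc 0 t → ContinuousAt G s) {ε : ℝ} (hε : 0 < ε) :
    ∃ δ > 0, ∃ O : ℝ → ℝ, (∀ a b, IntervalIntegrable O volume a b) ∧ ∫ s in 0..t, O s < ε ∧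
      ∀ r s, |r - s| < δ → |G r - G s| ≤ O s := by
  -- The oscillation of `G` at scale `δ`. It tends to `0` at each continuity point and is bounded by
  -- `2 * C`, so its integral tends to `0` by dominated convergence.
  let O : ℝ → ℝ → ℝ := fun δ s => (Metric.ediam (G '' Metric.ball s δ)).toReal
  have hbd : ∀ A : Set ℝ, Metric.ediam (G '' A) ≤ ENNReal.ofReal (2 * C) := by
    intro A
    rw [Metric.ediam_image_le_iff]
    intro x _ y _
    rw [edist_dist]
    refine ENNReal.ofReal_le_ofReal ?_
    rw [Real.dist_eq]
    have := abs_sub (G x) (G y)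
    linarith [hC x, hC y]
  have hmeas : ∀ δ, Measurable (O δ) := by
    intro δ
    refine ENNReal.measurable_toReal.comp (measurable_of_Ioi fun c => IsOpen.measurableSet ?_)
    -- Measurability comes from lower semicontinuity: because balls are open, a pair of points
    -- witnessing diameter above `c` stays in the ball when the centre moves slightly.
    rw [isOpen_iff_mem_nhds]
    intro s hs
    simp only [Set.mem_preimage, Set.mem_Ioi] at hs
    rw [← not_le, Metric.ediam_image_le_iff] at hs
    push Not at hs
    obtain ⟨x, hx, y, hy, hxy⟩ := hs
    rw [Metric.mem_ball'] at hx hy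
    have h1 : ∀ᶠ s' in 𝓝 s, dist s' x < δ := by
      have : Continuous fun s' : ℝ => dist s' x := by fun_prop
      exact this.tendsto s (Iio_mem_nhds hx)
    have h2 : ∀ᶠ s' in 𝓝 s, dist s' y < δ := by
      have : Continuous fun s' : ℝ => dist s' y := by fun_prop
      exact this.tendsto s (Iio_mem_nhds hy)
    filter_upwards [h1, h2] with s' hx' hy'
    exact hxy.trans_le (Metric.edist_le_ediam_of_mem ⟨x, Metric.mem_ball'.2 hx', rfl⟩
      ⟨y, Metric.mem_ball'.2 hy', rfl⟩)
  have hC0 : 0 ≤ C := (abs_nonneg _).trans (hC 0)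
  have hle : ∀ δ s, ‖O δ s‖ ≤ 2 * C := by
    intro δ s
    rw [Real.norm_of_nonneg ENNReal.toReal_nonneg]
    exact ENNReal.toReal_le_of_le_ofReal (by positivity) (hbd _)
  have hint : ∀ δ a b, IntervalIntegrable (O δ) volume a b := fun δ a b =>
    (intervalIntegrable_const (c := 2 * C)).mono_fun (hmeas δ).aestronglyMeasurable
      (ae_of_all _ fun s => by
        rw [Real.norm_of_nonneg (by positivity : (0 : ℝ) ≤ 2 * C)]; exact hle δ s)
  have hlim : Tendsto (fun n : ℕ => ∫ s in 0..t, O (1 / ((n : ℝ) + 1)) s) atTop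
      (𝓝 (∫ s in 0..t, (0 : ℝ))) := by
    refine intervalIntegral.tendsto_integral_filter_of_dominated_convergence (fun _ => 2 * C)
      (Eventually.of_forall fun n => (hmeas _).aestronglyMeasurable)
      (Eventually.of_forall fun n => ae_of_all _ fun s _ => hle _ s)
      intervalIntegrable_const ?_
    filter_upwards [hG] with s hs hst
    rw [Metric.tendsto_nhds]
    intro η hη
    obtain ⟨d, hd, h⟩ := Metric.continuousAt_iff.1 (hs hst) (η / 4) (by positivity)
    filter_upwards [tendsto_one_div_add_atTop_nhds_zero_nat.eventually (gt_mem_nhds hd)] with n hn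
    rw [dist_zero_right, Real.norm_of_nonneg ENNReal.toReal_nonneg]
    refine (ENNReal.toReal_le_of_le_ofReal (b := η / 2) (by positivity) ?_).trans_lt (by linarith)
    rw [Metric.ediam_image_le_iff]
    intro x hx y hy
    rw [edist_dist]
    refine ENNReal.ofReal_le_ofReal ?_
    have h1 := h (lt_trans (Metric.mem_ball.1 hx) hn)
    have h2 := h (lt_trans (Metric.mem_ball.1 hy) hn)
    linarith [dist_triangle_right (G x) (G y) (G s)]
  rw [intervalIntegral.integral_zero] at hlim
  obtain ⟨n, hn⟩ := (hlim.eventually (gt_mem_nhds hε)).exists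
  refine ⟨1 / ((n : ℝ) + 1), by positivity, _, hint _, hn, fun r s hrs => ?_⟩
  rw [← Real.dist_eq, dist_edist]
  refine ENNReal.toReal_mono (ne_top_of_le_ne_top ENNReal.ofReal_ne_top (hbd _)) ?_
  exact Metric.edist_le_ediam_of_mem ⟨r, by rwa [Metric.mem_ball, Real.dist_eq], rfl⟩
    ⟨s, Metric.mem_ball_self (by positivity), rfl⟩

/-- Integration by parts: a continuously differentiable function is Riemann-Stieltjes integrable
with respect to a càdlàg function. -/
theorem hasRSIntegral_of_isCadlagPath {f f' : ℝ → ℝ} (hf : ∀ s, HasDerivAt f (f' s) s)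
    (hf' : Continuous f') {g : ℝ≥0 → ℝ} (hg : IsCadlagPath g) (t : ℝ≥0) :
    HasRSIntegral (fun s => f s) g t
      (f t * g t - f 0 * g 0 - ∫ s in (0 : ℝ)..t, f' s * g s.toNNReal) := by
  obtain ⟨C, hC⟩ := hg.exists_abs_le t
  obtain ⟨M, hM⟩ := (isCompact_Icc (a := (0 : ℝ)) (b := t)).exists_bound_of_continuousOn
    hf'.continuousOn
  have hM0 : 0 ≤ M := (norm_nonneg _).trans (hM 0 ⟨le_rfl, t.coe_nonneg⟩)
  have ht0 : (0 : ℝ) ≤ t := t.coe_nonneg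
  -- Freezing the path outside `[0, t]` gives a function bounded on the whole line, as
  -- `exists_oscillation_bound` requires.
  let G : ℝ → ℝ := fun s => g (min s.toNNReal t)
  have hGC : ∀ s, |G s| ≤ C := fun s => hC _ (min_le_right _ _)
  have hGg : ∀ s : ℝ≥0, s ≤ t → G s = g s := fun s hs => by simp [G, hs]
  let N : Set ℝ := (fun x : ℝ≥0 => (x : ℝ)) '' {x | ¬ ContinuousAt g x} ∪ {(t : ℝ)}
  have hN : N.Countable :=
    (hg.countable_not_continuousAt.image _).union (Set.countable_singleton _)
  have hcontN : ∀ s ∈ Set.uIoc 0 (t : ℝ), s ∉ N → ContinuousAt G s := by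
    intro s hst hs
    rw [Set.uIoc_of_le ht0] at hst
    rw [Set.mem_union, not_or] at hs
    have hst' : s < t := lt_of_le_of_ne hst.2 hs.2
    have h1 : ContinuousAt g s.toNNReal := by
      by_contra h
      exact hs.1 ⟨s.toNNReal, h, Real.coe_toNNReal _ hst.1.le⟩
    have h2 : ContinuousAt (fun r : ℝ => g r.toNNReal) s :=
      ContinuousAt.comp (f := Real.toNNReal) h1 continuous_real_toNNReal.continuousAt
    refine h2.congr ?_
    filter_upwards [Iio_mem_nhds hst'] with r hr
    simp only [G]
    rw [min_eq_left (Real.toNNReal_le_iff_le_coe.2 (le_of_lt hr))]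
  have hcont : ∀ᵐ s : ℝ, s ∈ Set.uIoc 0 (t : ℝ) → ContinuousAt G s := by
    filter_upwards [hN.ae_notMem volume] with s hs hst using hcontN s hst hs
  have hae : AEStronglyMeasurable G (volume.restrict (Set.uIoc 0 (t : ℝ))) := by
    have h0 : volume.restrict (Set.uIoc 0 (t : ℝ)) = volume.restrict (Set.uIoc 0 (t : ℝ) \ N) :=
      Measure.restrict_congr_set (sdiff_null_ae_eq_self (hN.measure_zero volume)).symm
    rw [h0]
    exact ContinuousOn.aestronglyMeasurable
      (fun s hs => (hcontN s hs.1 hs.2).continuousWithinAt)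
      (measurableSet_uIoc.diff hN.measurableSet)
  have hGint : ∀ a b : ℝ, 0 ≤ a → a ≤ b → b ≤ t → ∀ h : ℝ → ℝ, Continuous h →
      IntervalIntegrable (fun s => h s * G s) volume a b := by
    intro a b ha hab hb h hh
    have : IntervalIntegrable G volume 0 t :=
      (intervalIntegrable_const (c := C)).mono_fun hae (ae_of_all _ fun s => by
        rw [Real.norm_of_nonneg ((abs_nonneg _).trans (hGC 0))]; exact hGC s)
    refine (this.mono_set ?_).continuousOn_mul hh.continuousOn
    rw [Set.uIcc_of_le hab, Set.uIcc_of_le ht0]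
    exact Set.Icc_subset_Icc ha hb
  intro ε hε
  obtain ⟨δ, hδ, O, hOint, hO, hGO⟩ := exists_oscillation_bound hGC hcont
    -- The final error is at most `M * ∫ O`; dividing by `M + 1` also covers `M = 0`.
    (ε := ε / (M + 1)) (by positivity)
  refine ⟨δ, hδ, fun n x ξ hx0 hxn hx => ?_⟩
  -- The left side is the integral of `f' s * (G r - G s)` over `[p, q]`, and `r` and `s` are closer
  -- than `δ`.
  have key : ∀ p q r : ℝ≥0, p ≤ r → r ≤ q → q ≤ t → (q : ℝ) - p < δ →
      |(f q - f p) * g r - ∫ s in (p : ℝ)..q, f' s * G s| ≤ M * ∫ s in (p : ℝ)..q, O s := by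
    intro p q r hpr hrq hqt hδ'
    have hpq : (p : ℝ) ≤ q := by exact_mod_cast hpr.trans hrq
    rw [← intervalIntegral.integral_eq_sub_of_hasDerivAt (fun s _ => hf s)
      (hf'.intervalIntegrable _ _), ← intervalIntegral.integral_mul_const,
      ← intervalIntegral.integral_sub
        (Continuous.intervalIntegrable (u := fun s => f' s * g r) (by fun_prop) _ _)
        (hGint p q p.coe_nonneg hpq (by exact_mod_cast hqt) f' hf'),
      ← intervalIntegral.integral_const_mul, ← Real.norm_eq_abs]
    refine intervalIntegral.norm_integral_le_of_norm_le hpq (ae_of_all _ fun s hs => ?_)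
      ((hOint _ _).const_mul M)
    rw [← mul_sub, norm_mul, ← hGg r (hrq.trans hqt)]
    have hst : s ∈ Set.Icc (0 : ℝ) t :=
      ⟨p.coe_nonneg.trans hs.1.le, hs.2.trans (by exact_mod_cast hqt)⟩
    refine mul_le_mul (hM s hst) (hGO _ _ ?_) (norm_nonneg _) hM0
    have h1 : (p : ℝ) ≤ r := by exact_mod_cast hpr
    have h2 : (r : ℝ) ≤ q := by exact_mod_cast hrq
    rw [abs_lt]
    constructor <;> linarith [hs.1, hs.2]
  have hstep : ∀ i < n, x i ≤ x (i + 1) := fun i hi => (hx i hi).1.trans (hx i hi).2.1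
  have hxt : ∀ i ≤ n, x i ≤ t := by
    intro i hi
    rw [← hxn]
    exact Nat.decreasingInduction' (P := fun i => x i ≤ x n)
      (fun k hk _ ih => (hstep k hk).trans ih) hi le_rfl
  -- Summation by parts on one cell, split at the tag: the first two terms combine to `(f ξ - f x)
  -- g(x) + (f x' - f ξ) g(x')`, where `x`, `x'` are the endpoints. So `key` applies on each side of
  -- the tag, with `r` the outer endpoint.
  have hterm : ∀ i ∈ Finset.range n,
      |(f (x (i + 1)) * g (x (i + 1)) - f (x i) * g (x i)) - f (ξ i) * (g (x (i + 1)) - g (x i))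
        - ∫ s in (x i : ℝ)..x (i + 1), f' s * G s| ≤ M * ∫ s in (x i : ℝ)..x (i + 1), O s := by
    intro i hi
    rw [Finset.mem_range] at hi
    obtain ⟨h1, h2, h3⟩ := hx i hi
    have h1' : (x i : ℝ) ≤ ξ i := by exact_mod_cast h1
    have h2' : (ξ i : ℝ) ≤ x (i + 1) := by exact_mod_cast h2
    have ht := hxt (i + 1) hi
    have k1 := key (x i) (ξ i) (x i) le_rfl h1 (h2.trans ht) (by linarith)
    have k2 := key (ξ i) (x (i + 1)) (x (i + 1)) h2 le_rfl ht (by linarith)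
    have ht' : (x (i + 1) : ℝ) ≤ t := by exact_mod_cast ht
    rw [← intervalIntegral.integral_add_adjacent_intervals (hOint (x i) (ξ i))
        (hOint (ξ i) (x (i + 1))),
      ← intervalIntegral.integral_add_adjacent_intervals
        (hGint (x i) (ξ i) (x i).coe_nonneg h1' (h2'.trans ht') f' hf')
        (hGint (ξ i) (x (i + 1)) (ξ i).coe_nonneg h2' ht' f' hf'), mul_add]
    refine le_trans (le_of_eq ?_) ((abs_add_le _ _).trans (add_le_add k1 k2))
    congr 1
    ring
  have hsum := (Finset.abs_sum_le_sum_abs _ _).trans (Finset.sum_le_sum hterm)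
  have hcongr : ∫ s in (0 : ℝ)..t, f' s * g s.toNNReal = ∫ s in (0 : ℝ)..t, f' s * G s := by
    refine intervalIntegral.integral_congr fun s hs => ?_
    rw [Set.uIcc_of_le ht0] at hs
    simp only [G]
    rw [min_eq_left (Real.toNNReal_le_iff_le_coe.2 hs.2)]
  have hI : ∑ i ∈ Finset.range n, ∫ s in (x i : ℝ)..x (i + 1), f' s * G s =
      ∫ s in (0 : ℝ)..t, f' s * G s := by
    rw [intervalIntegral.sum_integral_adjacent_intervals (a := fun i => (x i : ℝ))
      fun k hk => hGint _ _ (x k).coe_nonneg (by exact_mod_cast hstep k hk)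
        (by exact_mod_cast hxt (k + 1) hk) f' hf', hx0, hxn, NNReal.coe_zero]
  have hOsum : ∑ i ∈ Finset.range n, ∫ s in (x i : ℝ)..x (i + 1), O s = ∫ s in (0 : ℝ)..t, O s := by
    rw [intervalIntegral.sum_integral_adjacent_intervals (a := fun i => (x i : ℝ))
      fun k _ => hOint _ _, hx0, hxn, NNReal.coe_zero]
  rw [Finset.sum_sub_distrib, Finset.sum_sub_distrib, ← Finset.mul_sum, hI, hOsum,
    Finset.sum_range_sub (fun i => f (x i) * g (x i)), hx0, hxn, NNReal.coe_zero] at hsum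
  rw [hcongr, abs_sub_comm]
  refine lt_of_le_of_lt (le_trans (le_of_eq (by congr 1; ring)) hsum) ?_
  have h0 : 0 ≤ ∫ s in (0 : ℝ)..t, O s :=
    intervalIntegral.integral_nonneg ht0 fun s _ =>
      (abs_nonneg _).trans (hGO s s (by simpa using hδ))
  rw [lt_div_iff₀ (by positivity)] at hO
  nlinarith

/-! ### Characteristic functions of Wiener-Lévy integrals. -/

/-- Left Riemann sums over uniform partitions of `[0, t]` converge to the integral. -/
theorem tendsto_uniform_riemannSum {h : ℝ → ℂ} (hh : Continuous h) {t : ℝ} (ht : 0 ≤ t) :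
    Tendsto (fun n : ℕ => ∑ i ∈ Finset.range (n + 1),
        ((t / ((n : ℝ) + 1) : ℝ) : ℂ) * h (t / ((n : ℝ) + 1) * i))
      atTop (𝓝 (∫ s in 0..t, h s)) := by
  rw [Metric.tendsto_nhds]
  intro ε hε
  have huc := (isCompact_Icc (a := (0 : ℝ)) (b := t)).uniformContinuousOn_of_continuous
    hh.continuousOn
  obtain ⟨δ, hδ, hd⟩ := Metric.uniformContinuousOn_iff.1 huc (ε / (t + 1)) (by positivity)
  have hlim : Tendsto (fun n : ℕ => t / ((n : ℝ) + 1)) atTop (𝓝 0) := by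
    simpa [div_eq_mul_inv] using
      (tendsto_one_div_add_atTop_nhds_zero_nat (𝕜 := ℝ)).const_mul t
  filter_upwards [hlim.eventually (gt_mem_nhds hδ)] with n hn
  set d : ℝ := t / ((n : ℝ) + 1) with hd_def
  have hd0 : 0 ≤ d := by positivity
  have hdn : d * ((n + 1 : ℕ) : ℝ) = t := by
    rw [hd_def]; push_cast; field_simp
  have hI : ∑ i ∈ Finset.range (n + 1), ∫ s in (d * (i : ℕ))..(d * ((i + 1 : ℕ) : ℝ)), h s =
      ∫ s in 0..t, h s := by
    rw [intervalIntegral.sum_integral_adjacent_intervals (a := fun i : ℕ => d * (i : ℝ))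
      fun k _ => hh.intervalIntegrable _ _, hdn, Nat.cast_zero, mul_zero]
  rw [← hI, dist_eq_norm, ← Finset.sum_sub_distrib]
  have hterm : ∀ i ∈ Finset.range (n + 1),
      ‖(d : ℂ) * h (d * i) - ∫ s in (d * (i : ℕ))..(d * ((i + 1 : ℕ) : ℝ)), h s‖
        ≤ ε / (t + 1) * d := by
    intro i hi
    rw [Finset.mem_range] at hi
    have hii : d * ((i + 1 : ℕ) : ℝ) = d * i + d := by push_cast; ring
    have hit : d * ((i + 1 : ℕ) : ℝ) ≤ t := by
      rw [← hdn]
      exact mul_le_mul_of_nonneg_left (by exact_mod_cast hi) hd0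
    rw [hii] at hit ⊢
    have hi0 : 0 ≤ d * (i : ℝ) := by positivity
    have hconst : (d : ℂ) * h (d * i) = ∫ _ in (d * (i : ℕ))..(d * (i : ℝ) + d), h (d * i) := by
      rw [intervalIntegral.integral_const]; simp
    rw [hconst, ← intervalIntegral.integral_sub intervalIntegrable_const
      (hh.intervalIntegrable _ _)]
    have := intervalIntegral.norm_integral_le_of_norm_le_const (C := ε / (t + 1))
      (a := d * (i : ℝ)) (b := d * (i : ℝ) + d) (f := fun s => h (d * i) - h s) ?_
    · simpa [abs_of_nonneg hd0] using this
    · intro s hs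
      rw [Set.uIoc_of_le (by linarith)] at hs
      rw [← dist_eq_norm]
      refine (hd _ ⟨hi0, by linarith⟩ _ ⟨by linarith [hs.1], by linarith [hs.2]⟩ ?_).le
      rw [Real.dist_eq, abs_lt]
      constructor <;> linarith [hs.1, hs.2]
  refine ((norm_sum_le _ _).trans (Finset.sum_le_sum hterm)).trans_lt ?_
  rw [Finset.sum_const, Finset.card_range, nsmul_eq_mul]
  have : ((n + 1 : ℕ) : ℝ) * (ε / (t + 1) * d) = ε * t / (t + 1) := by
    rw [← hdn]; ring
  rw [this, div_lt_iff₀ (by positivity)]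
  linarith

/-- The characteristic function of a Wiener-Lévy integral `∫_0^t f dL` of a deterministic
continuous function, when the integral exists as a pathwise Riemann-Stieltjes integral. -/
theorem IsLevyProcess.charFun_map_rsIntegral {Ω : Type*} [MeasurableSpace Ω] {P : Measure Ω}
    [IsProbabilityMeasure P] {L : ℝ≥0 → Ω → ℝ} (hL : IsLevyProcess L P) {ψ : ℝ → ℂ}
    (hψ : Continuous ψ)
    (hLψ : ∀ (t : ℝ≥0) (u : ℝ), charFun (P.map (L t)) u = Complex.exp ((t : ℝ) * ψ u))
    {f : ℝ → ℝ} (hf : Continuous f) {t : ℝ≥0} {Z : Ω → ℝ}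
    (hZ : ∀ᵐ ω ∂P, HasRSIntegral (fun s => f s) (fun s => L s ω) t (Z ω)) (u : ℝ) :
    charFun (P.map Z) u = Complex.exp (∫ s in (0 : ℝ)..t, ψ (f s * u)) := by
  let d : ℕ → ℝ≥0 := fun n => t / ((n : ℝ≥0) + 1)
  let x : ℕ → ℕ → ℝ≥0 := fun n i => d n * i
  have hx : ∀ n i, x n (i + 1) = x n i + d n := fun n i => by
    simp only [x]; push_cast; ring
  have hxmono : ∀ n, Monotone (x n) := fun n =>
    monotone_nat_of_le_succ fun i => by rw [hx]; exact le_self_add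
  let S : ℕ → Ω → ℝ := fun n ω =>
    ∑ i ∈ Finset.range (n + 1), f (x n i) * (L (x n (i + 1)) ω - L (x n i) ω)
  have hSmeas : ∀ n, Measurable (S n) := fun n =>
    Finset.measurable_sum _ fun i _ => ((hL.measurable _).sub (hL.measurable _)).const_mul _
  have hlim : Tendsto (fun n : ℕ => (t : ℝ) / ((n : ℝ) + 1)) atTop (𝓝 0) := by
    simpa [div_eq_mul_inv] using
      (tendsto_one_div_add_atTop_nhds_zero_nat (𝕜 := ℝ)).const_mul (t : ℝ)
  have hSZ : ∀ᵐ ω ∂P, Tendsto (fun n => S n ω) atTop (𝓝 (Z ω)) := by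
    filter_upwards [hZ] with ω hω
    rw [Metric.tendsto_nhds]
    intro ε hε
    obtain ⟨δ, hδ, h⟩ := hω ε hε
    filter_upwards [hlim.eventually (gt_mem_nhds hδ)] with n hn
    refine h (n + 1) (x n) (x n) (by simp [x]) ?_ fun i _ => ⟨le_rfl, hxmono n i.le_succ, ?_⟩
    · simp only [x, d]; push_cast; field_simp
    · rw [hx]; push_cast; simpa [d] using hn
  -- Measurability of `Z` is not assumed; it is inherited from the almost sure limit.
  have hZmeas : AEMeasurable Z P :=
    aemeasurable_of_tendsto_metrizable_ae _ (fun n => (hSmeas n).aemeasurable) hSZ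
  have hcf : ∀ {Y : Ω → ℝ}, AEMeasurable Y P →
      charFun (P.map Y) u = ∫ ω, Complex.exp (u * Y ω * Complex.I) ∂P := by
    intro Y hY
    rw [charFun_apply_real, integral_map hY (by fun_prop)]
  have hlimZ : Tendsto (fun n => charFun (P.map (S n)) u) atTop (𝓝 (charFun (P.map Z) u)) := by
    simp_rw [hcf (hSmeas _).aemeasurable, hcf hZmeas]
    refine tendsto_integral_of_dominated_convergence (fun _ => 1)
      (fun n => ?_) (integrable_const _) (fun n => ae_of_all _ fun ω => ?_) ?_
    · have := hSmeas n
      exact Measurable.aestronglyMeasurable (by fun_prop)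
    · rw [← Complex.ofReal_mul, Complex.norm_exp_ofReal_mul_I]
    · filter_upwards [hSZ] with ω hω
      have hc : Continuous fun y : ℝ => Complex.exp (u * y * Complex.I) := by fun_prop
      exact (hc.tendsto _).comp hω
  have hincr : ∀ n i v, charFun (P.map fun ω => L (x n (i + 1)) ω - L (x n i) ω) v =
      Complex.exp ((d n : ℝ) * ψ v) := by
    intro n i v
    simp_rw [hx]
    rw [(hL.stationary (x n i) (d n)).map_eq, hLψ]
  have hS : ∀ n, charFun (P.map (S n)) u = Complex.exp (∑ i ∈ Finset.range (n + 1),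
      (((t : ℝ) / ((n : ℝ) + 1) : ℝ) : ℂ) * ψ (f ((t : ℝ) / ((n : ℝ) + 1) * i) * u)) := by
    intro n
    have hind : iIndepFun (fun (i : ℕ) ω => f (x n i) * (L (x n (i + 1)) ω - L (x n i) ω)) P :=
      (hL.indep.nat (hxmono n)).comp (fun i y => f (x n i) * y) fun i => by fun_prop
    have hprod := (hind.restrict (Finset.range (n + 1))).charFun_map_fun_finsetSum_eq_prod
      fun i _ => Measurable.aemeasurable (f := fun ω => f (x n i) *
        (L (x n (i + 1)) ω - L (x n i) ω)) (((hL.measurable _).sub (hL.measurable _)).const_mul _)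
    rw [show P.map (S n) = P.map fun ω => ∑ i ∈ Finset.range (n + 1),
      f (x n i) * (L (x n (i + 1)) ω - L (x n i) ω) from rfl, hprod, Finset.prod_apply,
      Complex.exp_sum]
    refine Finset.prod_congr rfl fun i _ => ?_
    have hY : Measurable fun ω => L (x n (i + 1)) ω - L (x n i) ω :=
      (hL.measurable _).sub (hL.measurable _)
    have := charFun_map_mul (μ := P.map fun ω => L (x n (i + 1)) ω - L (x n i) ω) (f (x n i)) u
    rw [Measure.map_map (by fun_prop) hY, hincr] at this
    simpa [Function.comp_def, d, x] using this
  simp_rw [hS] at hlimZ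
  refine tendsto_nhds_unique hlimZ ((Complex.continuous_exp.tendsto _).comp ?_)
  exact tendsto_uniform_riemannSum (h := fun s => ψ (f s * u)) (by fun_prop) t.coe_nonneg

/-! ### The Lévy-Khintchine exponent in closed form. -/

/-- Differentiation of `u ↦ ∫ (e^{iux} - c) k(x) dx` under the integral sign. -/
theorem hasDerivAt_integral_cexp_sub_mul {k : ℝ → ℝ} (hk : Measurable k) {c : ℂ} {u : ℝ}
    (hu : IntegrableOn (fun x : ℝ => (Complex.exp (Complex.I * u * x) - c) * k x) (Set.Ioi 0))
    (hxk : IntegrableOn (fun x : ℝ => x * k x) (Set.Ioi 0)) :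
    HasDerivAt (fun v : ℝ => ∫ x in Set.Ioi (0 : ℝ),
        (Complex.exp (Complex.I * v * x) - c) * k x)
      (Complex.I * ∫ x in Set.Ioi (0 : ℝ), Complex.exp (Complex.I * u * x) * ((x * k x : ℝ) : ℂ))
      u := by
  have h := hasDerivAt_integral_of_dominated_loc_of_deriv_le (μ := volume.restrict (Set.Ioi 0))
    (F := fun (v : ℝ) (x : ℝ) => (Complex.exp (Complex.I * v * x) - c) * k x)
    (F' := fun (v : ℝ) (x : ℝ) =>
      Complex.I * (Complex.exp (Complex.I * v * x) * ((x * k x : ℝ) : ℂ)))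
    (x₀ := u) (s := Set.univ) (bound := fun x => ‖x * k x‖) univ_mem
    (Eventually.of_forall fun v => Measurable.aestronglyMeasurable (by fun_prop)) hu
    (Measurable.aestronglyMeasurable (by fun_prop))
    (ae_of_all _ fun x v _ => ?_) hxk.norm (ae_of_all _ fun x v _ => ?_)
  · rw [← integral_const_mul]
    exact h.2
  · rw [norm_mul, norm_mul, Complex.norm_I, one_mul, Complex.norm_real, mul_assoc,
      ← Complex.ofReal_mul, Complex.norm_exp_I_mul_ofReal, one_mul]
  · have h1 : HasDerivAt (fun v : ℝ => Complex.I * v * x) (Complex.I * x) v := by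
      simpa using ((Complex.ofRealCLM.hasDerivAt (x := v)).const_mul Complex.I).mul_const (x : ℂ)
    convert! (h1.cexp.sub_const c).mul_const (k x : ℂ) using 1
    push_cast
    ring

theorem integrableOn_rpow_mul_exp_neg_mul {p β : ℝ} (hp : -1 < p) (hβ : 0 < β) :
    IntegrableOn (fun x : ℝ => x ^ p * Real.exp (-β * x)) (Set.Ioi 0) := by
  simpa using integrableOn_rpow_mul_exp_neg_mul_rpow hp one_pos hβ

theorem sub_I_mul_mem_slitPlane {β : ℝ} (hβ : 0 < β) (u : ℝ) :
    (β : ℂ) - Complex.I * u ∈ Complex.slitPlane :=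
  Or.inl (by simpa using hβ)

theorem hasDerivAt_sub_I_mul_cpow {β : ℝ} (hβ : 0 < β) (s : ℂ) (u : ℝ) :
    HasDerivAt (fun v : ℝ => ((β : ℂ) - Complex.I * v) ^ s)
      (-(Complex.I * (s * ((β : ℂ) - Complex.I * u) ^ (s - 1)))) u := by
  have h1 : HasDerivAt (fun v : ℝ => (β : ℂ) - Complex.I * v) (-Complex.I) u := by
    simpa using ((Complex.ofRealCLM.hasDerivAt (x := u)).const_mul Complex.I).const_sub (β : ℂ)
  convert! HasDerivAt.comp u
    ((hasDerivAt_id ((β : ℂ) - Complex.I * u)).cpow_const (c := s) (sub_I_mul_mem_slitPlane hβ u)) h1 using 1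
  simp
  ring

/-- Euler's integral for the Gamma function with complex rate `β - iu`. -/
theorem integral_rpow_mul_cexp_Ioi {s β : ℝ} (hs : 0 < s) (hβ : 0 < β) (u : ℝ) :
    ∫ x in Set.Ioi (0 : ℝ), Complex.exp (Complex.I * u * x) *
        ((x ^ (s - 1) * Real.exp (-β * x) : ℝ) : ℂ) =
      Real.Gamma s * ((β : ℂ) - Complex.I * u) ^ (-s : ℂ) := by
  set g : ℝ → ℂ := fun v => ∫ x in Set.Ioi (0 : ℝ), Complex.exp (Complex.I * v * x) *
        ((x ^ (s - 1) * Real.exp (-β * x) : ℝ) : ℂ) with hg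
  set J : ℝ → ℂ := fun v => ∫ x in Set.Ioi (0 : ℝ), Complex.exp (Complex.I * v * x) *
        ((x ^ s * Real.exp (-β * x) : ℝ) : ℂ) with hJ
  have hxx : ∀ x ∈ Set.Ioi (0 : ℝ), x * (x ^ (s - 1) * Real.exp (-β * x)) =
      x ^ s * Real.exp (-β * x) := by
    intro x hx
    rw [← mul_assoc, Real.rpow_sub_one (ne_of_gt hx), mul_div_cancel₀ _ (ne_of_gt hx)]
  have hint : ∀ {p : ℝ} (_ : -1 < p) (v : ℝ), IntegrableOn (fun x : ℝ =>
      Complex.exp (Complex.I * v * x) * ((x ^ p * Real.exp (-β * x) : ℝ) : ℂ)) (Set.Ioi 0) := by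
    intro p hp v
    refine (integrableOn_rpow_mul_exp_neg_mul hp hβ).mono'
      (Measurable.aestronglyMeasurable (by fun_prop)) ?_
    filter_upwards [ae_restrict_mem measurableSet_Ioi] with x hx
    rw [norm_mul, mul_assoc, ← Complex.ofReal_mul, Complex.norm_exp_I_mul_ofReal, one_mul,
      Complex.norm_real, Real.norm_of_nonneg]
    have : (0 : ℝ) < x := hx
    positivity
  have hgd : ∀ v, HasDerivAt g (Complex.I * J v) v := by
    intro v
    have := hasDerivAt_integral_cexp_sub_mul (k := fun x => x ^ (s - 1) * Real.exp (-β * x))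
      (c := 0) (u := v) (by fun_prop) (by simpa using hint (by linarith : -1 < s - 1) v)
      ((integrableOn_rpow_mul_exp_neg_mul (by linarith : -1 < s) hβ).congr_fun
        (fun x hx => (hxx x hx).symm) measurableSet_Ioi)
    simp only [sub_zero] at this
    convert! this using 2
    refine setIntegral_congr_fun measurableSet_Ioi fun x hx => ?_
    simp only [hxx x hx]
  -- Integration by parts: the boundary terms of `e^{ivx} x^s e^{-βx}` vanish at `0` and at
  -- infinity. Together with `g' = iJ` this is a linear differential equation for `g`.
  have hgJ : ∀ v : ℝ, ((β : ℂ) - Complex.I * v) * J v = s * g v := by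
    intro v
    have hzero := integral_Ioi_of_hasDerivAt_of_tendsto (a := (0 : ℝ)) (m := (0 : ℂ))
      (f := fun x : ℝ => Complex.exp (Complex.I * v * x) * ((x ^ s * Real.exp (-β * x) : ℝ) : ℂ))
      (f' := fun x : ℝ => s * (Complex.exp (Complex.I * v * x) *
          ((x ^ (s - 1) * Real.exp (-β * x) : ℝ) : ℂ)) -
        ((β : ℂ) - Complex.I * v) * (Complex.exp (Complex.I * v * x) *
          ((x ^ s * Real.exp (-β * x) : ℝ) : ℂ)))
      ?_ ?_ ?_ ?_
    · rw [integral_sub ((hint (by linarith) v).const_mul _) ((hint (by linarith) v).const_mul _),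
        integral_const_mul, integral_const_mul] at hzero
      simp only [Real.zero_rpow hs.ne', zero_mul, Complex.ofReal_zero, mul_zero, sub_zero]
        at hzero
      exact (sub_eq_zero.1 hzero).symm
    · have : Continuous fun x : ℝ => x ^ s := Real.continuous_rpow_const hs.le
      exact Continuous.continuousWithinAt (by fun_prop)
    · intro x hx
      have hx0 : x ≠ 0 := ne_of_gt hx
      have h1 : HasDerivAt (fun y : ℝ => Complex.exp (Complex.I * v * y))
          (Complex.exp (Complex.I * v * x) * (Complex.I * v)) x := by
        have : HasDerivAt (fun y : ℝ => Complex.I * v * y) (Complex.I * v) x := by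
          simpa using (Complex.ofRealCLM.hasDerivAt (x := x)).const_mul (Complex.I * v)
        exact this.cexp
      have h2 : HasDerivAt (fun y : ℝ => Real.exp (-β * y)) (Real.exp (-β * x) * -β) x := by
        simpa using ((hasDerivAt_id x).const_mul (-β)).exp
      convert! h1.mul ((Real.hasDerivAt_rpow_const (Or.inl hx0)).mul h2).ofReal_comp using 1
      simp only [Pi.mul_apply]
      push_cast
      ring
    · exact ((hint (by linarith) v).const_mul _).sub ((hint (by linarith) v).const_mul _)
    · rw [tendsto_zero_iff_norm_tendsto_zero]
      refine (tendsto_rpow_mul_exp_neg_mul_atTop_nhds_zero s β hβ).congr' ?_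
      filter_upwards [eventually_gt_atTop 0] with x hx
      rw [norm_mul, mul_assoc, ← Complex.ofReal_mul, Complex.norm_exp_I_mul_ofReal, one_mul,
        Complex.norm_real, Real.norm_of_nonneg (by positivity)]
  have hne : ∀ v : ℝ, (β : ℂ) - Complex.I * v ≠ 0 := fun v =>
    Complex.slitPlane_ne_zero (sub_I_mul_mem_slitPlane hβ v)
  -- The integrating factor `(β - iv)^s` makes the product constant, and its value at `v = 0` is the
  -- real Gamma integral.
  have hder : ∀ v : ℝ, HasDerivAt (fun v : ℝ => ((β : ℂ) - Complex.I * v) ^ (s : ℂ) * g v) 0 v := by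
    intro v
    convert! (hasDerivAt_sub_I_mul_cpow hβ s v).mul (hgd v) using 1
    rw [Complex.cpow_sub _ _ (hne v), Complex.cpow_one]
    have := hgJ v
    have hJ' : J v = s * g v / ((β : ℂ) - Complex.I * v) := by
      rw [eq_div_iff (hne v), mul_comm, this]
    rw [hJ']
    ring
  have hconst := is_const_of_deriv_eq_zero (fun v => (hder v).differentiableAt)
    (fun v => (hder v).deriv) u 0
  have hg0 : g 0 = ((1 / β) ^ s * Real.Gamma s : ℝ) := by
    rw [← Real.integral_rpow_mul_exp_neg_mul_Ioi hs hβ, ← integral_complex_ofReal]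
    simp [hg]
  have hβs : ((β : ℂ)) ^ (s : ℂ) = ((β ^ s : ℝ) : ℂ) := (Complex.ofReal_cpow hβ.le s).symm
  simp only [Complex.ofReal_zero, mul_zero, sub_zero, hg0, hβs] at hconst
  rw [← Complex.ofReal_mul, ← mul_assoc, ← Real.mul_rpow hβ.le (by positivity),
    mul_one_div_cancel hβ.ne', Real.one_rpow, one_mul] at hconst
  have hr : ((β : ℂ) - Complex.I * u) ^ (s : ℂ) ≠ 0 := by
    rw [Complex.cpow_ne_zero_iff]
    exact Or.inl (hne u)
  change g u = _
  rw [Complex.cpow_neg, ← hconst, mul_right_comm, mul_inv_cancel₀ hr, one_mul]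

/-- The Laplace exponent of a one-sided classic tempered stable process of finite variation
(for `c = 1`): `Γ(-α) ((β - iu)^α - β^α)`, with `Γ(-α)` written as `-Γ(1 - α) / α`. -/
noncomputable def ctsExponent (α β u : ℝ) : ℂ :=
  -((Real.Gamma (1 - α) / α : ℝ) : ℂ) *
    (((β : ℂ) - Complex.I * u) ^ (α : ℂ) - ((β ^ α : ℝ) : ℂ))

theorem ctsExponent_zero {α β : ℝ} (hβ : 0 < β) : ctsExponent α β 0 = 0 := by
  simp [ctsExponent, Complex.ofReal_cpow hβ.le]

theorem hasDerivAt_ctsExponent {α β : ℝ} (hα : α ≠ 0) (hβ : 0 < β) (u : ℝ) :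
    HasDerivAt (ctsExponent α β)
      (Complex.I * (Real.Gamma (1 - α) * ((β : ℂ) - Complex.I * u) ^ (α - 1 : ℂ))) u := by
  have hα' : (α : ℂ) ≠ 0 := by exact_mod_cast hα
  convert! ((hasDerivAt_sub_I_mul_cpow hβ α u).sub_const ((β ^ α : ℝ) : ℂ)).const_mul
    (-((Real.Gamma (1 - α) / α : ℝ) : ℂ)) using 1
  push_cast
  field_simp

theorem continuous_ctsExponent {α β : ℝ} (hα : α ≠ 0) (hβ : 0 < β) :
    Continuous (ctsExponent α β) :=
  continuous_iff_continuousAt.2 fun u => (hasDerivAt_ctsExponent hα hβ u).continuousAt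

/-- The bound `|e^{iux} - 1| ≤ |u| x` gains one power of `x` at the origin, leaving `x^{-α}`, which
is integrable there because `α < 1`. -/
theorem integrableOn_cexp_sub_one_mul_cts {α β : ℝ} (hα : α < 1) (hβ : 0 < β) (u : ℝ) :
    IntegrableOn (fun x : ℝ => (Complex.exp (Complex.I * u * x) - 1) *
      ((x ^ (-1 - α) * Real.exp (-β * x) : ℝ) : ℂ)) (Set.Ioi 0) := by
  refine ((integrableOn_rpow_mul_exp_neg_mul (by linarith : -1 < -α) hβ).const_mul |u|).mono'
    (Measurable.aestronglyMeasurable (by fun_prop)) ?_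
  filter_upwards [ae_restrict_mem measurableSet_Ioi] with x hx
  have hx0 : (0 : ℝ) < x := hx
  rw [norm_mul, Complex.norm_real, Real.norm_of_nonneg (by positivity), mul_assoc,
    ← Complex.ofReal_mul]
  refine (mul_le_mul_of_nonneg_right (Real.norm_exp_I_mul_ofReal_sub_one_le)
    (by positivity)).trans (le_of_eq ?_)
  rw [Real.norm_eq_abs, abs_mul, abs_of_pos hx0, show -1 - α = -α - 1 by ring,
    Real.rpow_sub_one hx0.ne']
  field_simp

/-- Both sides vanish at `u = 0` and have the same derivative, by Euler's integral with `s = 1 - α >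
0`. Differentiating first treats both signs of `α` at once. -/
theorem integral_cexp_sub_one_mul_cts {α β : ℝ} (hα : α < 1) (hα0 : α ≠ 0) (hβ : 0 < β) (u : ℝ) :
    ∫ x in Set.Ioi (0 : ℝ), (Complex.exp (Complex.I * u * x) - 1) *
      ((x ^ (-1 - α) * Real.exp (-β * x) : ℝ) : ℂ) = ctsExponent α β u := by
  have hxx : ∀ x ∈ Set.Ioi (0 : ℝ), x * (x ^ (-1 - α) * Real.exp (-β * x)) =
      x ^ (-α) * Real.exp (-β * x) := by
    intro x hx
    rw [← mul_assoc, show -1 - α = -α - 1 by ring, Real.rpow_sub_one (ne_of_gt hx),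
      mul_div_cancel₀ _ (ne_of_gt hx)]
  have hd : ∀ v : ℝ, HasDerivAt (fun v : ℝ => (∫ x in Set.Ioi (0 : ℝ),
      (Complex.exp (Complex.I * v * x) - 1) * ((x ^ (-1 - α) * Real.exp (-β * x) : ℝ) : ℂ)) -
        ctsExponent α β v) 0 v := by
    intro v
    have h := hasDerivAt_integral_cexp_sub_mul
      (k := fun x => x ^ (-1 - α) * Real.exp (-β * x)) (c := 1) (u := v) (by fun_prop)
      (integrableOn_cexp_sub_one_mul_cts hα hβ v)
      ((integrableOn_rpow_mul_exp_neg_mul (by linarith : -1 < -α) hβ).congr_fun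
        (fun x hx => (hxx x hx).symm) measurableSet_Ioi)
    have hG := integral_rpow_mul_cexp_Ioi (by linarith : 0 < 1 - α) hβ v
    rw [show 1 - α - 1 = -α by ring] at hG
    have hJ : ∫ x in Set.Ioi (0 : ℝ), Complex.exp (Complex.I * v * x) *
        ((x * (x ^ (-1 - α) * Real.exp (-β * x)) : ℝ) : ℂ) = _ :=
      (setIntegral_congr_fun measurableSet_Ioi fun x hx => by simp only [hxx x hx]).trans hG
    rw [hJ] at h
    convert! h.sub (hasDerivAt_ctsExponent hα0 hβ v) using 1
    push_cast
    rw [neg_sub, sub_self]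
  have h := is_const_of_deriv_eq_zero (fun v => (hd v).differentiableAt)
    (fun v => (hd v).deriv) u 0
  simpa [ctsExponent_zero hβ, sub_eq_zero] using h

theorem measurable_bctsDensity (αp αn βp βn cp cn : ℝ) :
    Measurable (bctsDensity αp αn βp βn cp cn) :=
  Measurable.ite measurableSet_Ioi (by fun_prop)
    (Measurable.ite measurableSet_Iio (by fun_prop) measurable_const)

theorem bctsDensity_nonneg {αp αn βp βn cp cn : ℝ} (hcp : 0 < cp) (hcn : 0 < cn) (x : ℝ) :
    0 ≤ bctsDensity αp αn βp βn cp cn x := by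
  unfold bctsDensity
  split_ifs <;> positivity

theorem bctsDensity_of_pos {αp αn βp βn cp cn x : ℝ} (hx : 0 < x) :
    bctsDensity αp αn βp βn cp cn x = cp * (x ^ (-1 - αp) * Real.exp (-βp * x)) := by
  rw [bctsDensity, if_pos hx, show -1 - αp = -(1 + αp) by ring, Real.rpow_neg hx.le]
  ring

theorem bctsDensity_neg_of_pos {αp αn βp βn cp cn x : ℝ} (hx : 0 < x) :
    bctsDensity αp αn βp βn cp cn (-x) = cn * (x ^ (-1 - αn) * Real.exp (-βn * x)) := by
  rw [bctsDensity, if_neg (by linarith), if_pos (by linarith), abs_neg, abs_of_pos hx,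
    show -1 - αn = -(1 + αn) by ring, Real.rpow_neg hx.le, mul_neg, neg_mul]
  ring

/-- The Lévy-Khintchine integral of a BCTS process of finite variation in closed form. -/
theorem integral_cexp_sub_one_bctsLevyMeasure {αp αn βp βn cp cn : ℝ}
    (hαp : αp < 1) (hαp0 : αp ≠ 0) (hαn : αn < 1) (hαn0 : αn ≠ 0)
    (hβp : 0 < βp) (hβn : 0 < βn) (hcp : 0 < cp) (hcn : 0 < cn) (u : ℝ) :
    ∫ x : ℝ, (Complex.exp (Complex.I * u * x) - 1) ∂(bctsLevyMeasure αp αn βp βn cp cn) =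
      cp * ctsExponent αp βp u + cn * ctsExponent αn βn (-u) := by
  set D := bctsDensity αp αn βp βn cp cn with hD
  set F : ℝ → ℂ := fun x => (D x : ℂ) * (Complex.exp (Complex.I * u * x) - 1) with hF
  have hν : ∫ x : ℝ, (Complex.exp (Complex.I * u * x) - 1)
      ∂(bctsLevyMeasure αp αn βp βn cp cn) = ∫ x, F x := by
    rw [bctsLevyMeasure, integral_withDensity_eq_integral_toReal_smul
      (measurable_bctsDensity αp αn βp βn cp cn).ennreal_ofReal
      (ae_of_all _ fun _ => ENNReal.ofReal_lt_top)]
    refine integral_congr_ae (ae_of_all _ fun x => ?_)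
    simp only [hF]
    rw [ENNReal.toReal_ofReal (bctsDensity_nonneg hcp hcn x), Complex.real_smul]
  have hpos : ∀ x ∈ Set.Ioi (0 : ℝ), F x = cp * ((Complex.exp (Complex.I * u * x) - 1) *
      ((x ^ (-1 - αp) * Real.exp (-βp * x) : ℝ) : ℂ)) := by
    intro x hx
    simp only [hF, hD]
    rw [bctsDensity_of_pos hx]
    push_cast
    ring
  have hneg : ∀ x ∈ Set.Ioi (0 : ℝ), F (-x) =
      cn * ((Complex.exp (Complex.I * (-u : ℝ) * x) - 1) *
        ((x ^ (-1 - αn) * Real.exp (-βn * x) : ℝ) : ℂ)) := by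
    intro x hx
    simp only [hF, hD]
    rw [bctsDensity_neg_of_pos hx, show Complex.I * u * ((-x : ℝ) : ℂ) =
      Complex.I * ((-u : ℝ) : ℂ) * x by push_cast; ring]
    push_cast
    ring
  have hip : IntegrableOn F (Set.Ioi 0) :=
    IntegrableOn.congr_fun ((integrableOn_cexp_sub_one_mul_cts hαp hβp u).const_mul (cp : ℂ))
      (fun x hx => (hpos x hx).symm) measurableSet_Ioi
  have hin : IntegrableOn F (Set.Iic 0) := by
    have : IntegrableOn (fun x => F (-x)) (Set.Ioi 0) :=
      IntegrableOn.congr_fun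
        ((integrableOn_cexp_sub_one_mul_cts hαn hβn (-u)).const_mul (cn : ℂ))
        (fun x hx => (hneg x hx).symm) measurableSet_Ioi
    rw [integrableOn_Iic_iff_integrableOn_Iio]
    simpa using this.comp_neg
  have hint : Integrable F := by
    rw [← integrableOn_univ, ← Set.Iic_union_Ioi (a := (0 : ℝ))]
    exact hin.union hip
  have hneg' := integral_comp_neg_Ioi 0 F
  rw [neg_zero] at hneg'
  rw [hν, ← integral_add_compl measurableSet_Ioi hint, Set.compl_Ioi, ← hneg',
    setIntegral_congr_fun measurableSet_Ioi hpos, setIntegral_congr_fun measurableSet_Ioi hneg,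
    integral_const_mul, integral_const_mul, integral_cexp_sub_one_mul_cts hαp hαp0 hβp,
    integral_cexp_sub_one_mul_cts hαn hαn0 hβn]

/-! ### The time integral along the Ornstein-Uhlenbeck kernel. -/

theorem ofReal_mul_cpow {r : ℝ} (hr : 0 < r) {w : ℂ} (hw : w ≠ 0) (α : ℂ) :
    ((r : ℂ) * w) ^ α = (r : ℂ) ^ α * w ^ α := by
  have hr' : (r : ℂ) ≠ 0 := by exact_mod_cast hr.ne'
  rw [Complex.cpow_def_of_ne_zero (mul_ne_zero hr' hw), Complex.cpow_def_of_ne_zero hr',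
    Complex.cpow_def_of_ne_zero hw, Complex.log_ofReal_mul hr hw, ← Complex.exp_add,
    Complex.ofReal_log hr.le, add_mul]

theorem continuousOn_ctsI_integrand (α u : ℝ) :
    ContinuousOn (fun z : ℝ => ((z ^ (-1 - α) : ℝ) : ℂ) * ((z : ℂ) - Complex.I * u) ^ (α : ℂ))
      (Set.Ioi 0) := by
  intro z hz
  have hz' : (0 : ℝ) < z := hz
  refine ContinuousAt.continuousWithinAt (ContinuousAt.mul ?_ ?_)
  · exact Complex.continuous_ofReal.continuousAt.comp
      (Real.continuousAt_rpow_const _ _ (Or.inl hz'.ne'))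
  · exact ContinuousAt.cpow (by fun_prop) continuousAt_const (sub_I_mul_mem_slitPlane hz' u)

/-- The time integral of the exponent of a one-sided CTS process along the OU kernel. -/
theorem integral_ctsExponent_exp {b α β : ℝ} (hb : 0 < b) (hα0 : α ≠ 0) (hβ : 0 < β)
    (c : ℝ) (t : ℝ≥0) (u : ℝ) :
    c * ∫ s in (0 : ℝ)..t, ctsExponent α β (Real.exp (-b * (t - s)) * u) =
      ouCTSLogChar b α β c t u := by
  -- Substitution `z = φ s`, with `dz = -b z ds`. The `β^α` term of the exponent becomes the `1/z`
  -- in `F`, whose integral produces `log a`.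
  set φ : ℝ → ℝ := fun s => β * Real.exp (b * (t - s)) with hφ
  set F : ℝ → ℂ := fun z => ((z ^ (-1 - α) : ℝ) : ℂ) * ((z : ℂ) - Complex.I * u) ^ (α : ℂ) -
    ((z⁻¹ : ℝ) : ℂ) with hF
  have hφpos : ∀ s, 0 < φ s := fun s => by positivity
  have hφd : ∀ s, HasDerivAt φ (-b * φ s) s := by
    intro s
    have h1 : HasDerivAt (fun s : ℝ => b * (t - s)) (-b) s := by
      simpa using ((hasDerivAt_id s).const_sub (t : ℝ)).const_mul b
    convert! (h1.exp.const_mul β) using 1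
    simp only [hφ]
    ring
  have hFc : ContinuousOn F (Set.Ioi 0) :=
    (continuousOn_ctsI_integrand α u).sub (Complex.continuous_ofReal.comp_continuousOn
      (continuousOn_inv₀.mono fun z hz => ne_of_gt hz))
  have hsub := intervalIntegral.integral_deriv_smul_comp' (a := 0) (b := t) (f := φ)
    (f' := fun s => -b * φ s) (g := F) (fun s _ => hφd s)
    (Continuous.continuousOn (by fun_prop))
    (hFc.mono (by rintro _ ⟨s, _, rfl⟩; exact hφpos s))
  have hpt : ∀ s : ℝ, ctsExponent α β (Real.exp (-b * (t - s)) * u) =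
      ((Real.Gamma (1 - α) / α * β ^ α / b : ℝ) : ℂ) * ((-b * φ s) • (F ∘ φ) s) := by
    intro s
    have he : φ s / β = Real.exp (b * (t - s)) := by simp only [hφ]; field_simp
    have hq : 0 < φ s / β := by rw [he]; positivity
    -- Pulling out the positive factor `φ s / β` is compatible with principal powers and moves the
    -- time dependence out of the base.
    have hw : (φ s : ℂ) - Complex.I * u = ((φ s / β : ℝ) : ℂ) *
        ((β : ℂ) - Complex.I * ((Real.exp (-b * (t - s)) * u : ℝ) : ℂ)) := by
      have h1 : φ s / β * Real.exp (-b * (t - s)) = 1 := by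
        rw [he, ← Real.exp_add]; simp
      have h2 : ((φ s / β : ℝ) : ℂ) * (Real.exp (-b * (t - s)) : ℝ) = 1 := by exact_mod_cast h1
      have h3 : ((φ s / β : ℝ) : ℂ) * β = φ s := by
        rw [← Complex.ofReal_mul, div_mul_cancel₀ _ hβ.ne']
      rw [Complex.ofReal_mul (Real.exp _) u]
      linear_combination -h3 + Complex.I * u * h2
    have hpow : φ s * φ s ^ (-1 - α) = (φ s ^ α)⁻¹ := by
      rw [show -1 - α = -α - 1 by ring, Real.rpow_sub_one (hφpos s).ne',
        mul_div_cancel₀ _ (hφpos s).ne', Real.rpow_neg (hφpos s).le]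
    have hz1 : φ s * (φ s)⁻¹ = 1 := mul_inv_cancel₀ (hφpos s).ne'
    have hpow' : ((φ s : ℝ) : ℂ) * ((φ s ^ (-1 - α) : ℝ) : ℂ) = ((φ s ^ α : ℝ) : ℂ)⁻¹ := by
      exact_mod_cast hpow
    have hz1' : ((φ s : ℝ) : ℂ) * (((φ s)⁻¹ : ℝ) : ℂ) = 1 := by exact_mod_cast hz1
    have hbα : ((β ^ α : ℝ) : ℂ) ≠ 0 := by exact_mod_cast (Real.rpow_pos_of_pos hβ α).ne'
    have hφα : ((φ s ^ α : ℝ) : ℂ) ≠ 0 := by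
      exact_mod_cast (Real.rpow_pos_of_pos (hφpos s) α).ne'
    have hb' : (b : ℂ) ≠ 0 := by exact_mod_cast hb.ne'
    have hα' : (α : ℂ) ≠ 0 := by exact_mod_cast hα0
    simp only [Function.comp_apply, hF]
    rw [hw, ofReal_mul_cpow hq (Complex.slitPlane_ne_zero (sub_I_mul_mem_slitPlane hβ _)),
      ← Complex.ofReal_cpow hq.le, Real.div_rpow (hφpos s).le hβ.le, Complex.real_smul,
      ctsExponent]
    set W := ((β : ℂ) - Complex.I * ((Real.exp (-b * (t - s)) * u : ℝ) : ℂ)) ^ (α : ℂ)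
    have : ((-b * φ s : ℝ) : ℂ) * (((φ s ^ (-1 - α) : ℝ) : ℂ) *
        (((φ s ^ α / β ^ α : ℝ) : ℂ) * W) - (((φ s)⁻¹ : ℝ) : ℂ)) =
        -b * (((β ^ α : ℝ) : ℂ)⁻¹ * W - 1) := by
      rw [Complex.ofReal_mul, Complex.ofReal_div, Complex.ofReal_neg]
      calc _ = -(b : ℂ) * (((φ s : ℝ) : ℂ) * ((φ s ^ (-1 - α) : ℝ) : ℂ) *
            (((φ s ^ α : ℝ) : ℂ) / ((β ^ α : ℝ) : ℂ) * W) -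
              ((φ s : ℝ) : ℂ) * (((φ s)⁻¹ : ℝ) : ℂ)) := by ring
        _ = _ := by rw [hpow', hz1']; field_simp
    rw [this]
    simp only [Complex.ofReal_div, Complex.ofReal_mul]
    field_simp
  have hφ0 : φ 0 = β / Real.exp (-b * t) := by
    simp only [hφ]
    rw [neg_mul, Real.exp_neg, sub_zero, div_inv_eq_mul]
  have hφt : φ t = β := by simp [hφ]
  have hle : β ≤ β / Real.exp (-b * t) := by
    rw [le_div_iff₀ (Real.exp_pos _)]
    refine mul_le_of_le_one_right hβ.le (Real.exp_le_one_iff.2 ?_)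
    have := mul_nonneg hb.le t.coe_nonneg
    linarith
  have hsubset : Set.uIcc β (β / Real.exp (-b * t)) ⊆ Set.Ioi 0 := by
    rw [Set.uIcc_of_le hle]
    exact fun z hz => hβ.trans_le hz.1
  have hFint : ∫ z in β..β / Real.exp (-b * t), F z =
      ctsI u α β (β / Real.exp (-b * t)) + (Real.log (Real.exp (-b * t)) : ℂ) := by
    have hinv : IntervalIntegrable (fun z : ℝ => ((z⁻¹ : ℝ) : ℂ)) volume β
        (β / Real.exp (-b * t)) :=
      ContinuousOn.intervalIntegrable (Complex.continuous_ofReal.comp_continuousOn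
        (continuousOn_inv₀.mono fun z hz => ne_of_gt (hsubset hz)))
    rw [intervalIntegral.integral_sub
      ((continuousOn_ctsI_integrand α u).mono hsubset).intervalIntegrable
      hinv,
      intervalIntegral.integral_ofReal, integral_inv (fun h => lt_irrefl (0 : ℝ) (hsubset h)), ctsI,
      sub_eq_add_neg, ← Complex.ofReal_neg]
    congr 3
    rw [div_div_cancel_left' hβ.ne', Real.log_inv, neg_neg]
  simp_rw [hpt]
  -- Since `φ` decreases from `β / a` to `β`, the limits come out reversed; the sign from swapping
  -- them is the leading minus of `ouCTSLogChar`.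
  rw [intervalIntegral.integral_const_mul, hsub, hφ0, hφt, intervalIntegral.integral_symm,
    hFint, ouCTSLogChar]
  push_cast
  ring

/-! ### Radial averages and the principal branch of the hypergeometric function. -/

/-- The weighted radial average `∫_0^1 s^a H(sz) ds` of a function `H`. -/
noncomputable def radialAverage (a : ℝ) (H : ℂ → ℂ) (z : ℂ) : ℂ :=
  ∫ s in (0 : ℝ)..1, ((s ^ a : ℝ) : ℂ) * H (s * z)

theorem StarConvex.ofReal_mul_mem {U : Set ℂ} (hU : StarConvex ℝ 0 U) {z : ℂ} (hz : z ∈ U)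
    {s : ℝ} (hs : s ∈ Set.Icc (0 : ℝ) 1) : (s : ℂ) * z ∈ U := by
  simpa using hU hz (sub_nonneg.2 hs.2) hs.1 (sub_add_cancel 1 s)

section RadialAverage

variable {U : Set ℂ} {H : ℂ → ℂ} {a : ℝ} {z : ℂ}

theorem continuousOn_comp_ofReal_mul {h : ℂ → ℂ} (hU : StarConvex ℝ 0 U) (hh : ContinuousOn h U)
    (hz : z ∈ U) : ContinuousOn (fun s : ℝ => h (s * z)) (Set.Icc 0 1) :=
  hh.comp (by fun_prop) fun _ hs => hU.ofReal_mul_mem hz hs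

theorem intervalIntegrable_rpow_mul {h : ℂ → ℂ} (ha : -1 < a) (hU : StarConvex ℝ 0 U)
    (hh : ContinuousOn h U) (hz : z ∈ U) :
    IntervalIntegrable (fun s : ℝ => ((s ^ a : ℝ) : ℂ) * h (s * z)) volume 0 1 := by
  refine IntervalIntegrable.mul_continuousOn
    ⟨Integrable.ofReal (intervalIntegral.intervalIntegrable_rpow' ha).1,
      Integrable.ofReal (intervalIntegral.intervalIntegrable_rpow' ha).2⟩ ?_
  rw [Set.uIcc_of_le zero_le_one]
  exact continuousOn_comp_ofReal_mul hU hh hz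

/-- Differentiation under the integral: the segments from `0` to a closed ball around `z` fill a
compact subset of `U`, on which `deriv H` is bounded, and `s ^ a` is integrable since `a > -1`. -/
theorem hasDerivAt_radialAverage (ha : -1 < a) (hUo : IsOpen U) (hU : StarConvex ℝ 0 U)
    (hH : DifferentiableOn ℂ H U) (hz : z ∈ U) :
    HasDerivAt (radialAverage a H)
      (∫ s in (0 : ℝ)..1, ((s ^ a : ℝ) : ℂ) * (s * deriv H (s * z))) z := by
  have hH' : ContinuousOn (deriv H) U := (hH.deriv hUo).continuousOn
  obtain ⟨ε, hε, hball⟩ := Metric.nhds_basis_closedBall.mem_iff.1 (hUo.mem_nhds hz)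
  have hK : IsCompact ((fun p : ℝ × ℂ => (p.1 : ℂ) * p.2) ''
      (Set.Icc 0 1 ×ˢ Metric.closedBall z ε)) :=
    (isCompact_Icc.prod (isCompact_closedBall z ε)).image (by fun_prop)
  obtain ⟨M, hM⟩ := hK.exists_bound_of_continuousOn (f := deriv H) (hH'.mono (by
    rintro _ ⟨p, hp, rfl⟩
    exact hU.ofReal_mul_mem (hball hp.2) hp.1))
  have hmem : ∀ {s : ℝ}, s ∈ Set.uIoc (0 : ℝ) 1 → s ∈ Set.Icc (0 : ℝ) 1 := fun hs => by
    rw [Set.uIoc_of_le zero_le_one] at hs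
    exact Set.Ioc_subset_Icc_self hs
  refine (intervalIntegral.hasDerivAt_integral_of_dominated_loc_of_deriv_le
    (F := fun (w : ℂ) (s : ℝ) => ((s ^ a : ℝ) : ℂ) * H (s * w))
    (F' := fun (w : ℂ) (s : ℝ) => ((s ^ a : ℝ) : ℂ) * (s * deriv H (s * w)))
    (bound := fun s => s ^ a * M) (Metric.closedBall_mem_nhds z hε) ?_
    (intervalIntegrable_rpow_mul ha hU hH.continuousOn hz) ?_ (ae_of_all _ fun s hs w hw => ?_)
    ((intervalIntegral.intervalIntegrable_rpow' ha).mul_const M)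
    (ae_of_all _ fun s hs w hw => ?_)).2
  · filter_upwards [hUo.mem_nhds hz] with w hw
    exact (intervalIntegrable_iff.1
      (intervalIntegrable_rpow_mul ha hU hH.continuousOn hw)).aestronglyMeasurable
  · have h1 := (intervalIntegrable_rpow_mul ha hU hH' hz).continuousOn_mul
      (g := fun s : ℝ => (s : ℂ)) (by fun_prop)
    refine (intervalIntegrable_iff.1 (h1.congr ?_)).aestronglyMeasurable
    exact fun s _ => by ring
  · have hs' := hmem hs
    have h2 := hM _ ⟨(s, w), ⟨hs', hw⟩, rfl⟩
    have h3 : 0 ≤ s ^ a := Real.rpow_nonneg hs'.1 a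
    rw [norm_mul, norm_mul, Complex.norm_real, Complex.norm_real, Real.norm_of_nonneg h3,
      Real.norm_of_nonneg hs'.1]
    refine mul_le_mul_of_nonneg_left ?_ h3
    exact (mul_le_of_le_one_left (norm_nonneg _) hs'.2).trans h2
  · have hmemU := hU.ofReal_mul_mem (hball hw) (hmem hs)
    have h1 : HasDerivAt (fun w : ℂ => (s : ℂ) * w) s w := by
      simpa using (hasDerivAt_id w).const_mul (s : ℂ)
    have h2 := ((hH.differentiableAt (hUo.mem_nhds hmemU)).hasDerivAt.comp w h1).const_mul
      ((s ^ a : ℝ) : ℂ)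
    convert! h2 using 1
    ring

/-- The Euler equation `z G' + (1 + a) G = H` for the radial average `G` of `H`. -/
theorem mul_deriv_radialAverage_add (ha : -1 < a) (hUo : IsOpen U) (hU : StarConvex ℝ 0 U)
    (hH : DifferentiableOn ℂ H U) (hz : z ∈ U) :
    z * deriv (radialAverage a H) z + (1 + a) * radialAverage a H z = H z := by
  have hH' : ContinuousOn (deriv H) U := (hH.deriv hUo).continuousOn
  have hi1 := intervalIntegrable_rpow_mul ha hU hH.continuousOn hz
  have hi2 : IntervalIntegrable (fun s : ℝ => ((s ^ a : ℝ) : ℂ) * (s * deriv H (s * z)))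
      volume 0 1 := by
    refine ((intervalIntegrable_rpow_mul ha hU hH' hz).continuousOn_mul
      (g := fun s : ℝ => (s : ℂ)) (by fun_prop)).congr fun s _ => by ring
  -- The combined integrand is the derivative of `s^{1+a} H(sz)`, which vanishes at `s = 0` because
  -- `1 + a > 0`.
  rw [(hasDerivAt_radialAverage ha hUo hU hH hz).deriv, radialAverage,
    ← intervalIntegral.integral_const_mul, ← intervalIntegral.integral_const_mul,
    ← intervalIntegral.integral_add (hi2.const_mul _) (hi1.const_mul _),
    intervalIntegral.integral_eq_sub_of_hasDerivAt_of_le zero_le_one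
      (f := fun s : ℝ => ((s ^ (1 + a) : ℝ) : ℂ) * H (s * z)) ?_ ?_
      ((hi2.const_mul _).add (hi1.const_mul _))]
  · simp [Real.zero_rpow (by linarith : 1 + a ≠ 0)]
  · refine ContinuousOn.mul ?_ (continuousOn_comp_ofReal_mul hU hH.continuousOn hz)
    exact (Complex.continuous_ofReal.comp
      (Real.continuous_rpow_const (by linarith))).continuousOn
  · intro s hs
    have hs0 : s ≠ 0 := hs.1.ne'
    have hmemU := hU.ofReal_mul_mem hz ⟨hs.1.le, hs.2.le⟩
    have h1 : HasDerivAt (fun s : ℝ => (s : ℂ) * z) z s := by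
      simpa using (Complex.ofRealCLM.hasDerivAt (x := s)).mul_const z
    have h2 := (hH.differentiableAt (hUo.mem_nhds hmemU)).hasDerivAt.comp s h1
    have h3 := (Real.hasDerivAt_rpow_const (x := s) (p := 1 + a) (Or.inl hs0)).ofReal_comp
    convert! h3.mul h2 using 1
    rw [show 1 + a - 1 = a by ring, show 1 + a = a + 1 by ring, Real.rpow_add_one hs0]
    push_cast
    simp only [Function.comp_apply]
    ring

end RadialAverage

/-- The plane cut along `[1, ∞)`. -/
def cutPlane : Set ℂ := {z | 1 - z ∈ Complex.slitPlane}

theorem isOpen_cutPlane : IsOpen cutPlane :=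
  Complex.isOpen_slitPlane.preimage (by fun_prop)

theorem starConvex_cutPlane : StarConvex ℝ 0 cutPlane := by
  intro z hz p q hp hq hpq
  have h := Complex.starConvex_one_slitPlane hz hp hq hpq
  have hpq' : (p : ℂ) + q = 1 := by exact_mod_cast hpq
  change 1 - (p • (0 : ℂ) + q • z) ∈ Complex.slitPlane
  convert! h using 1
  simp only [Complex.real_smul]
  linear_combination -hpq'

theorem zero_mem_cutPlane : (0 : ℂ) ∈ cutPlane := by simp [cutPlane]

theorem differentiableOn_one_sub_cpow (α : ℂ) :
    DifferentiableOn ℂ (fun z : ℂ => (1 - z) ^ α) cutPlane := fun z hz =>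
  (DifferentiableAt.cpow_const (by fun_prop) hz).differentiableWithinAt

/-- The function `₂F₁(-α, -α; 1 - α; z) = 1 - α z ∫_0^1 s^{-α} h(sz) ds` with
`h(z) = ((1 - z)^α - 1) / z`. -/
noncomputable def ctsHypergeometric (α : ℝ) (z : ℂ) : ℂ :=
  1 - α * (z * radialAverage (-α) (dslope (fun w : ℂ => (1 - w) ^ (α : ℂ)) 0) z)

theorem differentiableOn_dslope_one_sub_cpow (α : ℂ) :
    DifferentiableOn ℂ (dslope (fun w : ℂ => (1 - w) ^ α) 0) cutPlane :=
  (Complex.differentiableOn_dslope (isOpen_cutPlane.mem_nhds zero_mem_cutPlane)).2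
    (differentiableOn_one_sub_cpow α)

theorem mul_dslope_one_sub_cpow (α z : ℂ) :
    z * dslope (fun w : ℂ => (1 - w) ^ α) 0 z = (1 - z) ^ α - 1 := by
  simpa using sub_smul_dslope (fun w : ℂ => (1 - w) ^ α) 0 z

/-- With `F = 1 - α z G`, the Euler equation `z G' + (1 - α) G = h` and `z h = (1 - z)^α - 1`
combine to the stated equation. -/
theorem hasDerivAt_ctsHypergeometric {α : ℝ} (hα : α < 1) {z : ℂ} (hz : z ∈ cutPlane) :
    ∃ F', HasDerivAt (ctsHypergeometric α) F' z ∧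
      z * F' - α * ctsHypergeometric α z = -α * (1 - z) ^ (α : ℂ) := by
  have ha : -1 < -α := by linarith
  have hH := differentiableOn_dslope_one_sub_cpow (α : ℂ)
  have hd := hasDerivAt_radialAverage ha isOpen_cutPlane starConvex_cutPlane hH hz
  have hE := mul_deriv_radialAverage_add ha isOpen_cutPlane starConvex_cutPlane hH hz
  rw [hd.deriv] at hE
  refine ⟨_, (((hasDerivAt_id z).mul hd).const_mul (α : ℂ)).const_sub 1, ?_⟩
  have hm := mul_dslope_one_sub_cpow (α : ℂ) z
  simp only [ctsHypergeometric, id, one_mul]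
  push_cast at hE
  linear_combination (-α * z) * hE - α * hm

theorem hasSum_one_sub_cpow (α : ℂ) {z : ℂ} (hz : ‖z‖ < 1) :
    HasSum (fun n : ℕ => (n.factorial : ℂ)⁻¹ * (ascPochhammer ℂ n).eval (-α) * z ^ n)
      ((1 - z) ^ α) := by
  have h := (Complex.one_add_cpow_hasFPowerSeriesOnBall_zero (a := α)).hasSum (y := -z)
    (by rw [← ENNReal.ofReal_one, Metric.eball_ofReal]; simpa using hz)
  rw [zero_add, ← sub_eq_add_neg] at h
  convert! h using 2 with n
  -- The parameter `b` occurs above and below and cancels; `b = 1` makes its Pochhammer symbol `n!`,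
  -- which is nonzero.
  rw [binomialSeries_eq_ordinaryHypergeometricSeries (b := (1 : ℂ)) (by norm_cast; simp)]
  have h1 : (ascPochhammer ℂ n).eval 1 ≠ 0 := by
    rw [ascPochhammer_eval_one]
    exact_mod_cast n.factorial_ne_zero
  rw [FormalMultilinearSeries.compContinuousLinearMap_apply,
    show (⇑(-ContinuousLinearMap.id ℂ ℂ) ∘ fun _ : Fin n => -z) = fun _ => z by ext; simp,
    ordinaryHypergeometricSeries_apply_eq, mul_inv_cancel_right₀ h1, smul_eq_mul]

theorem ascPochhammer_eval_add_one_mul (a : ℂ) (n : ℕ) :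
    a * (ascPochhammer ℂ n).eval (a + 1) = (ascPochhammer ℂ n).eval a * (a + n) := by
  rw [← ascPochhammer_succ_eval, ascPochhammer_succ_left]
  simp

/-- The binomial series without its constant term is integrated termwise, since `∫_0^1 s^{n-α} ds =
1/(n+1-α)`. The coefficients match because `(-α)_{n+1} / (1-α)_{n+1} = -α/(n+1-α)`. -/
theorem ctsHypergeometric_eq_ordinaryHypergeometric {α : ℝ} (hα : α < 1) {z : ℂ} (hz : ‖z‖ < 1) :
    ctsHypergeometric α z = ordinaryHypergeometric (-α : ℂ) (-α) (1 - α) z := by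
  set p : ℕ → ℂ := fun n => (n.factorial : ℂ)⁻¹ * (ascPochhammer ℂ n).eval (-α : ℂ) with hp
  have hne : ∀ n : ℕ, ((n : ℂ) + 1 - α) ≠ 0 := by
    intro n h
    have : ((n : ℝ) + 1 - α) = 0 := by exact_mod_cast h
    have hn : (0 : ℝ) ≤ n := n.cast_nonneg
    linarith
  have hint : HasSum (fun n : ℕ => ∫ s in (0 : ℝ)..1, ((s ^ (-α + n) : ℝ) : ℂ) *
      (p (n + 1) * z ^ (n + 1)))
      (∫ s in (0 : ℝ)..1, z * (((s ^ (-α) : ℝ) : ℂ) *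
        dslope (fun w : ℂ => (1 - w) ^ (α : ℂ)) 0 (s * z))) := by
    have hsum : Summable fun n : ℕ => ‖p (n + 1)‖ * ‖z‖ ^ (n + 1) := by
      have h := (summable_nat_add_iff 1).2 (hasSum_one_sub_cpow (α : ℂ) hz).summable.norm
      simpa [hp] using h
    refine intervalIntegral.hasSum_integral_of_dominated_convergence
      (fun n s => s ^ (-α) * (‖p (n + 1)‖ * ‖z‖ ^ (n + 1))) (fun n => ?_)
      (fun n => ae_of_all _ fun s hs => ?_) (ae_of_all _ fun s _ => hsum.mul_left _) ?_
      (ae_of_all _ fun s hs => ?_)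
    · exact Measurable.aestronglyMeasurable (by fun_prop)
    · rw [Set.uIoc_of_le zero_le_one] at hs
      rw [norm_mul, norm_mul, norm_pow, Complex.norm_real,
        Real.norm_of_nonneg (Real.rpow_nonneg hs.1.le _), Real.rpow_add hs.1, Real.rpow_natCast]
      refine mul_le_mul_of_nonneg_right ?_ (by positivity)
      exact mul_le_of_le_one_right (Real.rpow_nonneg hs.1.le _) (pow_le_one₀ hs.1.le hs.2)
    · simp_rw [tsum_mul_left]
      exact (intervalIntegral.intervalIntegrable_rpow' (by linarith)).mul_const _
    · rw [Set.uIoc_of_le zero_le_one] at hs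
      have hs0 : (s : ℂ) ≠ 0 := by exact_mod_cast hs.1.ne'
      have hsz : ‖(s : ℂ) * z‖ < 1 := by
        rw [norm_mul, Complex.norm_real, Real.norm_of_nonneg hs.1.le]
        exact (mul_le_of_le_one_left (norm_nonneg _) hs.2).trans_lt hz
      have h := (hasSum_nat_add_iff' 1).2 (hasSum_one_sub_cpow (α : ℂ) hsz)
      simp only [Finset.sum_range_one, Nat.factorial_zero, Nat.cast_one, inv_one, one_mul,
        ascPochhammer_zero, Polynomial.eval_one, pow_zero] at h
      rw [← mul_dslope_one_sub_cpow] at h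
      have h' := h.mul_left (((s ^ (-α) : ℝ) : ℂ) * (s : ℂ)⁻¹)
      convert! h' using 1
      · funext n
        simp only [hp]
        rw [Real.rpow_add hs.1, Real.rpow_natCast, mul_pow, pow_succ (s : ℂ)]
        push_cast
        field_simp
      · field_simp
  have hterm : ∀ n : ℕ, ∫ s in (0 : ℝ)..1, ((s ^ (-α + n) : ℝ) : ℂ) *
      (p (n + 1) * z ^ (n + 1)) = ((n : ℂ) + 1 - α)⁻¹ * (p (n + 1) * z ^ (n + 1)) := by
    intro n
    have hn : (0 : ℝ) ≤ n := n.cast_nonneg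
    rw [intervalIntegral.integral_mul_const, intervalIntegral.integral_ofReal,
      integral_rpow (Or.inl (by linarith)), Real.one_rpow, Real.zero_rpow (by linarith)]
    push_cast
    rw [sub_zero, one_div, show -(α : ℂ) + n + 1 = n + 1 - α by ring]
  simp_rw [hterm] at hint
  rw [intervalIntegral.integral_const_mul] at hint
  rw [ordinaryHypergeometric_eq_tsum]
  refine (HasSum.tsum_eq ?_).symm
  rw [← hasSum_nat_add_iff' 1]
  convert! hint.mul_left (-α : ℂ) using 1
  · funext n
    have hA := ascPochhammer_eval_add_one_mul (-α : ℂ) (n + 1)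
    have hB : (ascPochhammer ℂ (n + 1)).eval (1 - α : ℂ) ≠ 0 := by
      rw [Ne, ascPochhammer_eval_eq_zero_iff]
      rintro ⟨k, _, hk⟩
      exact hne k (by linear_combination hk)
    rw [show (-α : ℂ) + 1 = 1 - α by ring] at hA
    push_cast at hA
    have h1 := hne n
    simp only [hp, smul_eq_mul]
    have : (ascPochhammer ℂ (n + 1)).eval (-α : ℂ) *
        ((ascPochhammer ℂ (n + 1)).eval (1 - α : ℂ))⁻¹ = -α * ((n : ℂ) + 1 - α)⁻¹ := by
      rw [← div_eq_mul_inv, ← div_eq_mul_inv, div_eq_div_iff hB h1]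
      linear_combination -hA
    linear_combination ((n + 1).factorial : ℂ)⁻¹ * (ascPochhammer ℂ (n + 1)).eval (-α : ℂ) *
      z ^ (n + 1) * this
  · simp [ctsHypergeometric, radialAverage]

theorem isPrincipalHypergeometric_ctsHypergeometric {α : ℝ} (hα : α < 1) :
    IsPrincipalHypergeometric (-α) (-α) (1 - α) (ctsHypergeometric α) := by
  refine ⟨fun z hz => ?_, fun z hz => ctsHypergeometric_eq_ordinaryHypergeometric hα hz⟩
  obtain ⟨F', hF', _⟩ := hasDerivAt_ctsHypergeometric hα hz
  exact hF'.differentiableAt.differentiableWithinAt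

theorem isPrincipalHypergeometric_gaussHypergeometric {α : ℝ} (hα : α < 1) :
    IsPrincipalHypergeometric (-α) (-α) (1 - α) (gaussHypergeometric (-α) (-α) (1 - α)) := by
  have h : ∃ F, IsPrincipalHypergeometric (-α) (-α) (1 - α) F :=
    ⟨_, isPrincipalHypergeometric_ctsHypergeometric hα⟩
  rw [gaussHypergeometric, dif_pos h]
  exact h.choose_spec

/-- `gaussHypergeometric` is obtained by choice; this uniqueness transfers the properties of the
explicit integral to it. -/
theorem IsPrincipalHypergeometric.eqOn {a b c : ℂ} {F G : ℂ → ℂ}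
    (hF : IsPrincipalHypergeometric a b c F) (hG : IsPrincipalHypergeometric a b c G) :
    Set.EqOn F G cutPlane := by
  refine (hF.1.analyticOnNhd isOpen_cutPlane).eqOn_of_preconnected_of_eventuallyEq
    (hG.1.analyticOnNhd isOpen_cutPlane)
    (starConvex_cutPlane.isPathConnected zero_mem_cutPlane).isConnected.isPreconnected zero_mem_cutPlane ?_
  filter_upwards [Metric.ball_mem_nhds (0 : ℂ) one_pos] with z hz
  rw [hF.2 z (by simpa using hz), hG.2 z (by simpa using hz)]

/-- The first-order equation satisfied by `₂F₁(-α, -α; 1 - α; z)`. -/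
theorem hasDerivAt_gaussHypergeometric {α : ℝ} (hα : α < 1) {z : ℂ} (hz : z ∈ cutPlane) :
    ∃ F', HasDerivAt (gaussHypergeometric (-α) (-α) (1 - α)) F' z ∧
      z * F' - α * gaussHypergeometric (-α) (-α) (1 - α) z = -α * (1 - z) ^ (α : ℂ) := by
  have heq := (isPrincipalHypergeometric_gaussHypergeometric hα).eqOn
    (isPrincipalHypergeometric_ctsHypergeometric hα)
  obtain ⟨F', hF', hE⟩ := hasDerivAt_ctsHypergeometric hα hz
  refine ⟨F', hF'.congr_of_eventuallyEq (heq.eventuallyEq_of_mem (isOpen_cutPlane.mem_nhds hz)), ?_⟩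
  rw [heq hz, hE]

/-! ### The hypergeometric form of the integral `I`. -/

/-- The arguments lie in `[-π/2, π/2]` and `(-π/2, π/2)`, so their sum stays inside `(-π, π)` and
the principal logarithms add. -/
theorem mul_cpow_of_re_nonneg_of_re_pos {z w : ℂ} (hz0 : z ≠ 0) (hz : 0 ≤ z.re) (hw : 0 < w.re)
    (α : ℂ) : (z * w) ^ α = z ^ α * w ^ α := by
  have hw0 : w ≠ 0 := by rintro rfl; simp at hw
  have h1 := abs_le.1 (Complex.abs_arg_le_pi_div_two_iff.2 hz)
  have h2 := abs_lt.1 (Complex.abs_arg_lt_pi_div_two_iff.2 (Or.inl hw))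
  have hlog := Complex.log_mul hz0 hw0 ⟨by linarith [h1.1, h2.1], by linarith [h1.2, h2.2]⟩
  rw [Complex.cpow_def_of_ne_zero (mul_ne_zero hz0 hw0), Complex.cpow_def_of_ne_zero hz0,
    Complex.cpow_def_of_ne_zero hw0, hlog, ← Complex.exp_add, add_mul]

/-- Put `Q = v/(iz)` and `w = -iz/v`. As `Q` has degree `-1` in `z` and `w` degree `1`, the
derivative of `Q^α F(w)` is `Q^α (w F' - α F) / z`, which the first-order equation turns into `-α
Q^α (1 - w)^α / z`. The factorisation `z - iv = z Q (1 - w)` finishes; powers multiply since `Q` is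
purely imaginary and `1 - w` has real part `1`. -/
theorem hasDerivAt_ctsHypTerm {α v z : ℝ} (hα : α < 1) (hv : v ≠ 0) (hz : 0 < z) :
    HasDerivAt (ctsHypTerm v α)
      (-α * (((z ^ (-1 - α) : ℝ) : ℂ) * ((z : ℂ) - Complex.I * v) ^ (α : ℂ))) z := by
  have hv' : (v : ℂ) ≠ 0 := by exact_mod_cast hv
  have hz' : (z : ℂ) ≠ 0 := by exact_mod_cast hz.ne'
  set Q : ℂ := (v : ℂ) / (Complex.I * z) with hQ
  set w : ℂ := -(Complex.I * z) / v with hw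
  have hQ' : Q = ((-(v / z) : ℝ) : ℂ) * Complex.I := by
    rw [hQ, mul_comm Complex.I, ← div_div, Complex.div_I]; push_cast; ring
  have hw' : w = ((-(z / v) : ℝ) : ℂ) * Complex.I := by
    rw [hw]; push_cast; ring
  have hQre : Q.re = 0 := by rw [hQ', Complex.re_ofReal_mul, Complex.I_re, mul_zero]
  have hQim : Q.im ≠ 0 := by
    rw [hQ', Complex.im_ofReal_mul, Complex.I_im, mul_one, neg_ne_zero]
    exact div_ne_zero hv hz.ne'
  have hQ0 : Q ≠ 0 := fun h => hQim (by rw [h, Complex.zero_im])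
  have h1w : (1 - w).re = 1 := by
    rw [hw', Complex.sub_re, Complex.re_ofReal_mul, Complex.I_re, mul_zero, Complex.one_re,
      sub_zero]
  have hprod : (z : ℂ) * (Q * (1 - w)) = (z : ℂ) - Complex.I * v := by
    rw [hQ, hw]
    field_simp
    linear_combination (v : ℂ) * Complex.I_sq
  have hpow : (z : ℂ) ^ (α : ℂ) * (Q ^ (α : ℂ) * (1 - w) ^ (α : ℂ)) =
      ((z : ℂ) - Complex.I * v) ^ (α : ℂ) := by
    rw [← mul_cpow_of_re_nonneg_of_re_pos hQ0 hQre.ge (by rw [h1w]; exact one_pos), ← hprod,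
      ofReal_mul_cpow hz]
    refine mul_ne_zero hQ0 fun h => ?_
    rw [h, Complex.zero_re] at h1w
    exact zero_ne_one h1w
  have hwU : w ∈ cutPlane := Or.inl (by rw [h1w]; exact one_pos)
  obtain ⟨F', hF', hE⟩ := hasDerivAt_gaussHypergeometric hα hwU
  have hid : HasDerivAt (fun y : ℝ => (y : ℂ)) 1 z := Complex.ofRealCLM.hasDerivAt
  have hdw : HasDerivAt (fun y : ℝ => -(Complex.I * (y : ℂ)) / v) (w / z) z := by
    convert! ((hid.const_mul Complex.I).neg.div_const (v : ℂ)) using 1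
    rw [hw]
    field_simp
  have hdQ : HasDerivAt (fun y : ℝ => (v : ℂ) / (Complex.I * (y : ℂ))) (-(Q / z)) z := by
    convert! (hasDerivAt_const z (v : ℂ)).div (hid.const_mul Complex.I)
      (mul_ne_zero Complex.I_ne_zero hz') using 1
    rw [hQ]
    field_simp
    ring
  have hdQα : HasDerivAt (fun y : ℝ => ((v : ℂ) / (Complex.I * (y : ℂ))) ^ (α : ℂ))
      (-(α * Q ^ (α : ℂ) / z)) z := by
    convert! HasDerivAt.comp z ((hasDerivAt_id Q).cpow_const (c := (α : ℂ)) (Or.inr hQim)) hdQ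
      using 1
    simp only [id, mul_one]
    rw [Complex.cpow_sub _ _ hQ0, Complex.cpow_one]
    field_simp
  have hdF := HasDerivAt.comp z hF' hdw
  have hzα : ((z ^ (-1 - α) : ℝ) : ℂ) * (z : ℂ) ^ (α : ℂ) = (z : ℂ)⁻¹ := by
    rw [← Complex.ofReal_cpow hz.le, ← Complex.ofReal_mul, ← Real.rpow_add hz,
      show -1 - α + α = -1 by ring, Real.rpow_neg_one, Complex.ofReal_inv]
  convert! hdQα.mul hdF using 1
  rw [← hpow]
  simp only [Function.comp_apply, ← hQ, ← hw]
  linear_combination (-α * (Q ^ (α : ℂ) * (1 - w) ^ (α : ℂ))) * hzα - Q ^ (α : ℂ) / z * hE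

/-- The integral `I` in terms of the Gauss hypergeometric function. -/
theorem ctsI_eq_ctsHypTerm {α v β₁ β₂ : ℝ} (hα : α < 1) (hα0 : α ≠ 0) (hv : v ≠ 0)
    (hβ₁ : 0 < β₁) (hβ₂ : 0 < β₂) :
    ctsI v α β₁ β₂ = -(1 / (α : ℂ)) * (ctsHypTerm v α β₂ - ctsHypTerm v α β₁) := by
  have hpos : Set.uIcc β₁ β₂ ⊆ Set.Ioi 0 := fun z hz => (lt_min hβ₁ hβ₂).trans_le hz.1
  have hα' : (α : ℂ) ≠ 0 := by exact_mod_cast hα0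
  rw [← intervalIntegral.integral_eq_sub_of_hasDerivAt
    (fun z hz => hasDerivAt_ctsHypTerm hα hv (hpos hz))
    (((continuousOn_ctsI_integrand α v).mono hpos).intervalIntegrable.const_mul _),
    intervalIntegral.integral_const_mul, ctsI]
  field_simp

/-! ### Assembly. -/

theorem mainTheorem4 {Ω : Type*} [MeasurableSpace Ω] (P : Measure Ω) [IsProbabilityMeasure P]
    (b αp αn βp βn cp cn : ℝ) (hb : 0 < b)
    (hαp : αp < 1) (hαp0 : αp ≠ 0) (hαn : αn < 1) (hαn0 : αn ≠ 0)
    (hβp : 0 < βp) (hβn : 0 < βn) (hcp : 0 < cp) (hcn : 0 < cn)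
    (L X : ℝ≥0 → Ω → ℝ) (hX : IsOUBCTSProcess b αp αn βp βn cp cn L X P) (t : ℝ≥0) :
    -- the pathwise integral defining `Z(t)` exists almost surely
    (∀ᵐ ω ∂P, HasRSIntegral (ouKernel b t) (fun s => L s ω) t (ouZ b L t ω)) ∧
    -- the log-characteristic function of `Z(t)`
    IsLogCharFun (P.map (ouZ b L t))
      (fun u => ouCTSLogChar b αp βp cp t u + ouCTSLogChar b αn βn cn t (-u)) ∧
    -- the hypergeometric form of the two integrals
    IsPrincipalHypergeometric (-αp) (-αp) (1 - αp) (gaussHypergeometric (-αp) (-αp) (1 - αp)) ∧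
    IsPrincipalHypergeometric (-αn) (-αn) (1 - αn) (gaussHypergeometric (-αn) (-αn) (1 - αn)) ∧
    ∀ u : ℝ, u ≠ 0 →
      ctsI u αp βp (βp / Real.exp (-b * t)) =
        -(1 / (αp : ℂ)) *
          (ctsHypTerm u αp (βp / Real.exp (-b * t)) - ctsHypTerm u αp βp) ∧
      ctsI (-u) αn βn (βn / Real.exp (-b * t)) =
        -(1 / (αn : ℂ)) *
          (ctsHypTerm (-u) αn (βn / Real.exp (-b * t)) - ctsHypTerm (-u) αn βn) := by
  have hL := hX.driver.levy
  have hZ : ∀ᵐ ω ∂P, HasRSIntegral (ouKernel b t) (fun s => L s ω) t (ouZ b L t ω) := by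
    filter_upwards [hL.cadlag] with ω hω
    have hd : ∀ s : ℝ, HasDerivAt (fun s : ℝ => Real.exp (-b * (t - s)))
        (Real.exp (-b * (t - s)) * b) s := by
      intro s
      have h1 : HasDerivAt (fun s : ℝ => -b * (t - s)) b s := by
        simpa using ((hasDerivAt_id s).const_sub (t : ℝ)).const_mul (-b)
      exact h1.exp
    have h : ∃ J, HasRSIntegral (ouKernel b t) (fun s => L s ω) t J :=
      ⟨_, hasRSIntegral_of_isCadlagPath hd (by fun_prop) hω t⟩
    -- Any chosen value of the integral serves: only the `HasRSIntegral` property is used, not the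
    -- integration-by-parts formula.
    rw [ouZ, rsIntegral, dif_pos h]
    exact h.choose_spec
  set ψ : ℝ → ℂ := fun u => cp * ctsExponent αp βp u + cn * ctsExponent αn βn (-u) with hψdef
  have hcp' := continuous_ctsExponent hαp0 hβp
  have hcn' := continuous_ctsExponent hαn0 hβn
  have hψ : Continuous ψ := by fun_prop
  have hLψ : ∀ (s : ℝ≥0) (u : ℝ), charFun (P.map (L s)) u = Complex.exp ((s : ℝ) * ψ u) := by
    intro s u
    rw [hX.driver.levyKhintchine, integral_cexp_sub_one_bctsLevyMeasure hαp hαp0 hαn hαn0 hβp hβn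
      hcp hcn]
  -- In this form continuity in `u` and the value at `0` are immediate, so the function is the right
  -- logarithm and not merely one up to multiples of `2πi`.
  have hlog : (fun u => ouCTSLogChar b αp βp cp t u + ouCTSLogChar b αn βn cn t (-u)) =
      fun u => ∫ s in (0 : ℝ)..t, ψ (Real.exp (-b * (t - s)) * u) := by
    funext u
    rw [← integral_ctsExponent_exp hb hαp0 hβp cp t u,
      ← integral_ctsExponent_exp hb hαn0 hβn cn t (-u), ← intervalIntegral.integral_const_mul,
      ← intervalIntegral.integral_const_mul, ← intervalIntegral.integral_add
        (Continuous.intervalIntegrable (by fun_prop) _ _)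
        (Continuous.intervalIntegrable (by fun_prop) _ _)]
    simp only [hψdef, mul_neg]
  refine ⟨hZ, ?_, isPrincipalHypergeometric_gaussHypergeometric hαp,
    isPrincipalHypergeometric_gaussHypergeometric hαn, fun u hu =>
    ⟨ctsI_eq_ctsHypTerm hαp hαp0 hu hβp (by positivity),
      ctsI_eq_ctsHypTerm hαn hαn0 (neg_ne_zero.2 hu) hβn (by positivity)⟩⟩
  rw [hlog]
  refine ⟨?_, ?_, fun u => ?_⟩
  · exact intervalIntegral.continuous_parametric_intervalIntegral_of_continuous'
      (f := fun u s => ψ (Real.exp (-b * (t - s)) * u)) (by fun_prop) _ _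
  · simp [hψdef, ctsExponent_zero hβp, ctsExponent_zero hβn]
  · exact hL.charFun_map_rsIntegral hψ hLψ (f := fun s => Real.exp (-b * (t - s)))
      (by fun_prop) hZ u
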